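/- Let $M\ge 0$ and $N_1,N_2\ge M$ be integers, $\sigma>0$, $\mathcal K=\{1,2\}$. Let ${\bm x}\sim\mathcal{CN}({\bm 0},{\bm I}_M)$, ${\bm n}_k\sim\mathcal{CN}({\bm 0},\sigma^2{\bm I}_{N_k})$ and ${\bm H}_k\in\mathbb C^{N_k\times M}$ with i.i.d. $\mathcal{CN}(0,1)$ entries ($k\in\mathcal K$) be mutually independent, and let relay $k$ observe ${\bm y}_k={\bm H}_k{\bm x}+{\bm n}_k$. Put $\tilde{\bm x}_k=({\bm H}_k^H{\bm H}_k)^{-1}{\bm H}_k^H{\bm y}_k$ and ${\bm A}_k=\sigma^2({\bm H}_k^H{\bm H}_k)^{-1}$, with diagonal entries $a_{k,1},\dots,a_{k,M}$. Let $\mathcal B\subset(0,\infty]$ be finite with $\infty\in\mathcal B$, let $\lceil a\rceil_{\mathcal B}=\min\{b\in\mathcal B: a\le b\}$, and let $\tilde{\bm A}_k^{(1)}=\mathrm{diag}\{\lceil a_{k,1}\rceil_{\mathcal B},\dots,\lceil a_{k,M}\rceil_{\mathcal B}\}$, $\tilde{\bm A}_{\mathcal K}^{(1)}=(\tilde{\bm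 A}_1^{(1)},\tilde{\bm A}_2^{(1)})$. Define $$\hat{\bm x}_k=\tilde{\bm x}_k+\tilde{\bm n}_k',\qquad \hat{\bm x}_k^{\rm g}={\bm x}+\hat{\bm n}_k^{\rm g},\qquad \hat{\bm z}_k=\hat{\bm x}_k+\hat{\bm w}_k,\qquad \hat{\bm z}_k^{\rm g}=\hat{\bm x}_k^{\rm g}+\hat{\bm w}_k,$$ where, given $({\bm H}_1,{\bm H}_2)$, the noises $\tilde{\bm n}_k'\sim\mathcal{CN}({\bm 0},\mathrm{diag}\{\lceil a_{k,i}\rceil_{\mathcal B}-a_{k,i}\}_{i})$, $\hat{\bm n}_k^{\rm g}\sim\mathcal{CN}({\bm 0},\tilde{\bm A}_k^{(1)})$ and $\hat{\bm w}_k\sim\mathcal{CN}({\bm 0},{\bm\Sigma}_{\hat{\bm w}_k})$, $k\in\mathcal K$, are independent of each other and of ${\bm x},{\bm n}_1,{\bm n}_2$, and where ${\bm\Sigma}_{\hat{\bm w}_k}$ is diagonal with entries in $[0,\infty]$ that are arbitrary functions of $\tilde{\bm A}_k^{(1)}$. An entry to which noise of infinite variance is added is erased, i.e. replaced by a constant.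 Thus $\hat{\bm x}_k$ is ${\bm x}$ plus noise that is correlated across entries, and $\hat{\bm x}_k^{\rm g}$ is its surrogate with diagonal noise covariance. For ${\mathcal T}\subseteq{\mathcal K}$ let $\overline{\mathcal T}={\mathcal K}\setminus{\mathcal T}$, and let a subscript $\mathcal T$ denote the family over $k\in\mathcal T$. Then, with (conditional) mutual information taking values in $[0,\infty]$, $$I(\hat{\bm x}_{\mathcal T};\hat{\bm z}_{\mathcal T}\mid\hat{\bm z}_{\overline{\mathcal T}},\tilde{\bm A}_{\mathcal K}^{(1)})\le I(\hat{\bm x}_{\mathcal T}^{\rm g};\hat{\bm z}_{\mathcal T}^{\rm g}\mid\hat{\bm z}_{\overline{\mathcal T}}^{\rm g},\tilde{\bm A}_{\mathcal K}^{(1)})\quad\text{for all }{\mathcal T}\subseteq{\mathcal K},$$ $$I({\bm x};\hat{\bm z}_{\mathcal K}\mid\tilde{\bm A}_{\mathcal K}^{(1)})\ge I({\bm x};\hat{\bm z}_{\mathcal K}^{\rm g}\mid\tilde{\bm A}_{\mathcal K}^{(1)}).$$ -/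

import Mathlib

open MeasureTheory ProbabilityTheory
open scoped ENNReal NNReal Matrix

namespace QCI

/-- Conditional mutual information `I(X; Y | Z)` in nats, with values in `[0, ∞]`: the
Kullback-Leibler divergence of the joint law of `(Z, (X, Y))` from the law under which `X` and `Y`
are conditionally independent given `Z` with the same conditional marginals. -/
noncomputable def condMutualInfo {Ω α β γ : Type*} [MeasurableSpace Ω]
    [MeasurableSpace α] [StandardBorelSpace α] [Nonempty α]
    [MeasurableSpace β] [StandardBorelSpace β] [Nonempty β] [MeasurableSpace γ]
    (X : Ω → α) (Y : Ω → β) (Z : Ω → γ) (μ : Measure Ω) [IsFiniteMeasure μ] : ℝ≥0∞ :=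
  InformationTheory.klDiv (μ.map (fun ω => (Z ω, (X ω, Y ω))))
    ((μ.map Z) ⊗ₘ ((condDistrib X Z μ) ×ₖ (condDistrib Y Z μ)))

/-- The circularly symmetric complex Gaussian law `CN(0, v)` on `ℂ`: real and imaginary parts are
independent centred real Gaussians of variance `v / 2`. -/
noncomputable def complexGaussian (v : ℝ≥0) : Measure ℂ :=
  ((gaussianReal 0 (v / 2)).prod (gaussianReal 0 (v / 2))).map
    (fun p => (⟨p.1, p.2⟩ : ℂ))

/-- The primitive random variables of the scheme with `M` source antennas and relays `k = 0, 1`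
with `N k` antennas: the input `x`, the channels `H k`, the receiver noises `n k`, and standard
Gaussian vectors generating the artificial noises (`gArt`), the surrogate noises (`gSur`) and the
compression noises (`gCmp`). -/
structure Variables (Ω : Type*) (M : ℕ) (N : Fin 2 → ℕ) where
  x : Ω → Fin M → ℂ
  H : (k : Fin 2) → Ω → Matrix (Fin (N k)) (Fin M) ℂ
  n : (k : Fin 2) → Ω → Fin (N k) → ℂ
  gArt : Fin 2 → Ω → Fin M → ℂ
  gSur : Fin 2 → Ω → Fin M → ℂ
  gCmp : Fin 2 → Ω → Fin M → ℂ

/-- Labels of all the scalar entries of the primitive random variables. -/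
inductive Label (M : ℕ) (N : Fin 2 → ℕ) : Type
  | x (i : Fin M)
  | H (k : Fin 2) (j : Fin (N k)) (i : Fin M)
  | n (k : Fin 2) (j : Fin (N k))
  | gArt (k : Fin 2) (i : Fin M)
  | gSur (k : Fin 2) (i : Fin M)
  | gCmp (k : Fin 2) (i : Fin M)

namespace Variables

variable {Ω : Type*} {M : ℕ} {N : Fin 2 → ℕ}

/-- The scalar random variable with a given label. -/
def entry (V : Variables Ω M N) : Label M N → Ω → ℂ
  | .x i => fun ω => V.x ω i
  | .H k j i => fun ω => V.H k ω j i
  | .n k j => fun ω => V.n k ω j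
  | .gArt k i => fun ω => V.gArt k ω i
  | .gSur k i => fun ω => V.gSur k ω i
  | .gCmp k i => fun ω => V.gCmp k ω i

/-- All scalar entries are independent; the entries of the receiver noises are `CN(0, σ²)` and all
the others are `CN(0, 1)`. -/
structure IsGaussian [MeasurableSpace Ω] (V : Variables Ω M N) (σ : ℝ≥0) (μ : Measure Ω) :
    Prop where
  indep : iIndepFun V.entry μ
  law_x : ∀ i, HasLaw (fun ω => V.x ω i) (complexGaussian 1) μ
  law_H : ∀ k j i, HasLaw (fun ω => V.H k ω j i) (complexGaussian 1) μ
  law_n : ∀ k j, HasLaw (fun ω => V.n k ω j) (complexGaussian (σ ^ 2)) μ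
  law_gArt : ∀ k i, HasLaw (fun ω => V.gArt k ω i) (complexGaussian 1) μ
  law_gSur : ∀ k i, HasLaw (fun ω => V.gSur k ω i) (complexGaussian 1) μ
  law_gCmp : ∀ k i, HasLaw (fun ω => V.gCmp k ω i) (complexGaussian 1) μ

end Variables

/-- The ceiling `⌈a⌉_B`: the least element of the grid `B` that is at least `a`. -/
noncomputable def gridCeil (B : Finset ℝ≥0∞) (a : ℝ≥0∞) : ℝ≥0∞ :=
  (B.filter (fun b => a ≤ b)).inf id

/-- `u` plus Gaussian noise of power `v ∈ [0, ∞]`, the noise being `√v` times the standard Gaussian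
`g`. Noise of infinite power erases `u`: the output is then a constant. -/
noncomputable def addNoise (v : ℝ≥0∞) (u g : ℂ) : ℂ :=
  if v = ∞ then 0 else u + (Real.sqrt v.toReal : ℂ) * g

namespace Variables

variable {Ω : Type*} {M : ℕ} {N : Fin 2 → ℕ} (V : Variables Ω M N) (σ : ℝ≥0)
  (B : Finset ℝ≥0∞) (s : Fin 2 → (Fin M → ℝ≥0∞) → Fin M → ℝ≥0∞)

/-- The observation of relay `k`: `y_k = H_k x + n_k`. -/
noncomputable def y (k : Fin 2) (ω : Ω) : Fin (N k) → ℂ :=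
  V.H k ω *ᵥ V.x ω + V.n k ω

/-- The zero-forcing estimate `(H_kᴴ H_k)⁻¹ H_kᴴ y_k` of relay `k`. -/
noncomputable def xTilde (k : Fin 2) (ω : Ω) : Fin M → ℂ :=
  (((V.H k ω)ᴴ * V.H k ω)⁻¹ * (V.H k ω)ᴴ) *ᵥ V.y k ω

/-- `A_k = σ² (H_kᴴ H_k)⁻¹`. -/
noncomputable def A (k : Fin 2) (ω : Ω) : Matrix (Fin M) (Fin M) ℂ :=
  ((σ : ℂ) ^ 2) • ((V.H k ω)ᴴ * V.H k ω)⁻¹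

/-- The noise level `a_{k,i}`: the (real, nonnegative) `i`-th diagonal entry of `A_k`. -/
noncomputable def a (k : Fin 2) (ω : Ω) (i : Fin M) : ℝ≥0∞ :=
  ENNReal.ofReal (V.A σ k ω i i).re

/-- The diagonal `⌈a_{k,i}⌉_B` of the quantized noise level matrix of relay `k`. -/
noncomputable def level (k : Fin 2) (ω : Ω) (i : Fin M) : ℝ≥0∞ :=
  gridCeil B (V.a σ k ω i)

/-- The quantized noise levels of both relays. -/
noncomputable def levels (ω : Ω) : Fin 2 → Fin M → ℝ≥0∞ :=
  fun k => V.level σ B k ω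

/-- The degraded estimate of relay `k`: the zero-forcing estimate plus independent artificial noise
of power `⌈a_{k,i}⌉_B - a_{k,i}` in entry `i`. -/
noncomputable def xHat (k : Fin 2) (ω : Ω) (i : Fin M) : ℂ :=
  addNoise (V.level σ B k ω i - V.a σ k ω i) (V.xTilde k ω i) (V.gArt k ω i)

/-- The surrogate of relay `k`: the input plus noise with diagonal conditional covariance
`diag(⌈a_{k,i}⌉_B)`. -/
noncomputable def xHatG (k : Fin 2) (ω : Ω) (i : Fin M) : ℂ :=
  addNoise (V.level σ B k ω i) (V.x ω i) (V.gSur k ω i)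

/-- The representation of `xHat`: compression noise is added whose diagonal covariance `s k` is a
function of the quantized noise levels of relay `k`. -/
noncomputable def zHat (k : Fin 2) (ω : Ω) (i : Fin M) : ℂ :=
  addNoise (s k (V.level σ B k ω) i) (V.xHat σ B k ω i) (V.gCmp k ω i)

/-- The representation of `xHatG`, with the same compression noise as in `zHat`. -/
noncomputable def zHatG (k : Fin 2) (ω : Ω) (i : Fin M) : ℂ :=
  addNoise (s k (V.level σ B k ω) i) (V.xHatG σ B k ω i) (V.gCmp k ω i)

end Variables

/-- The family `(X_k)_{k ∈ T}` as one random variable. -/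
def restrict {Ω α : Type*} (T : Finset (Fin 2)) (X : Fin 2 → Ω → α) : Ω → ({k // k ∈ T} → α) :=
  fun ω k => X k ω

end QCI

/-! Entry by entry, the scheme and its surrogate cannot be told apart. Fix `i` and condition on the
input, the channels and the compression noises. Almost surely the Gram matrices are invertible; then
entry `i` of the zero-forcing estimate is `x i` plus Gaussian noise of variance `a k i`, and the
artificial noise lifts this variance to the quantized level. So the pair of entries `i` over the two
relays has the same law as its surrogate (`map_base_xHat_eq`). The schemes differ only in the
dependence between different `i`. The surrogate sees the channel through the levels alone, so its
columns are independent given the levels.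

Both inequalities compare a vector problem with a sum of scalar problems that depend on entrywise
laws only. The tool is the golden formula: the divergence of `P(Y|Z,X)` from a reference kernel `κ`
that sees only `Z` is `I(X;Y|Z)` plus a nonnegative term, which vanishes when `κ` is the conditional
law of `Y` given `Z`.

For the rates (`condMutualInfo_le_of_memoryless`), compression acts on each entry separately. Let
the reference be the product of the surrogate's own scalar conditional laws. The rate of the scheme
is at most its divergence from this reference, hence at most a sum of scalar divergences. These
coincide with those of the surrogate, whose sum is by superadditivity at most the surrogate's
divergence from the reference, and that is its rate.

For the information about the input (`condMutualInfo_le_of_independent`), the reference is the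
product prior of `x`. The posterior of the surrogate factorizes, so its information is at most a sum
of scalar divergences; the same sum is by superadditivity at most the information of the true
scheme. No divergences are subtracted, so infinite values need no separate treatment. -/

namespace QCI

/-! ### Markov kernels: finite products, reordering and reparametrization -/

section Kernels

variable {𝓐 𝓑 𝓒 𝓓 : Type*} [MeasurableSpace 𝓐] [MeasurableSpace 𝓑] [MeasurableSpace 𝓒]
  [MeasurableSpace 𝓓]

/-- The product of finitely many Markov kernels with the same source. -/
noncomputable def kernelPi {ι : Type*} [Fintype ι] (κ : ι → Kernel 𝓐 𝓑)
    [∀ i, IsMarkovKernel (κ i)] : Kernel 𝓐 (ι → 𝓑) where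
  toFun a := Measure.pi fun i => κ i a
  measurable' := by
    refine Measurable.measure_of_isPiSystem_of_isProbabilityMeasure generateFrom_pi.symm
      isPiSystem_pi ?_
    rintro _ ⟨s, hs, rfl⟩
    simp only [Measure.pi_pi]
    exact Finset.measurable_prod _ fun i _ => (κ i).measurable_coe (hs i (Set.mem_univ i))

lemma kernelPi_apply {ι : Type*} [Fintype ι] (κ : ι → Kernel 𝓐 𝓑) [∀ i, IsMarkovKernel (κ i)]
    (a : 𝓐) : kernelPi κ a = Measure.pi fun i => κ i a := rfl

instance {ι : Type*} [Fintype ι] (κ : ι → Kernel 𝓐 𝓑) [∀ i, IsMarkovKernel (κ i)] :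
    IsMarkovKernel (kernelPi κ) :=
  ⟨fun a => by rw [kernelPi_apply]; infer_instance⟩

/-- The kernel sending `a` to the law of `φ (a, ω)`. -/
noncomputable def paramKernel (φ : 𝓐 × 𝓑 → 𝓒) (ν : Measure 𝓑) : Kernel 𝓐 𝓒 :=
  (Kernel.id ×ₖ Kernel.const 𝓐 ν).map φ

lemma paramKernel_apply {φ : 𝓐 × 𝓑 → 𝓒} (hφ : Measurable φ) (ν : Measure 𝓑) [SFinite ν] (a : 𝓐) :
    paramKernel φ ν a = ν.map fun b => φ (a, b) := by
  rw [paramKernel, Kernel.map_apply _ hφ, Kernel.prod_apply, Kernel.id_apply, Kernel.const_apply,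
    Measure.dirac_prod, Measure.map_map hφ measurable_prodMk_left]
  rfl

lemma isMarkovKernel_paramKernel {φ : 𝓐 × 𝓑 → 𝓒} (hφ : Measurable φ) (ν : Measure 𝓑)
    [IsProbabilityMeasure ν] : IsMarkovKernel (paramKernel φ ν) :=
  Kernel.IsMarkovKernel.map _ hφ

lemma map_prod_eq_compProd_paramKernel {F : 𝓐 → 𝓓} (hF : Measurable F) {φ : 𝓓 × 𝓑 → 𝓒}
    (hφ : Measurable φ) (μ : Measure 𝓐) [IsProbabilityMeasure μ] (ν : Measure 𝓑)
    [IsProbabilityMeasure ν] :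
    (μ.prod ν).map (fun p => (F p.1, φ (F p.1, p.2))) = μ.map F ⊗ₘ paramKernel φ ν := by
  have := isMarkovKernel_paramKernel hφ ν
  have hm : Measurable (fun p : 𝓐 × 𝓑 => (F p.1, φ (F p.1, p.2))) := by fun_prop
  refine Measure.ext_of_lintegral _ fun f hf => ?_
  rw [lintegral_map hf hm, lintegral_prod _ (by fun_prop),
    Measure.lintegral_compProd hf, lintegral_map (by fun_prop) hF]
  refine lintegral_congr fun a => ?_
  rw [paramKernel_apply hφ, lintegral_map (by fun_prop) (by fun_prop)]

lemma map_compProd_comap {f : 𝓐 → 𝓒} (hf : Measurable f) (m : Measure 𝓐) [IsProbabilityMeasure m]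
    (κ : Kernel 𝓒 𝓑) [IsMarkovKernel κ] :
    (m ⊗ₘ κ.comap f hf).map (fun p => (f p.1, p.2)) = m.map f ⊗ₘ κ := by
  refine Measure.ext_of_lintegral _ fun g hg => ?_
  rw [lintegral_map hg (by fun_prop), Measure.lintegral_compProd (by fun_prop),
    Measure.lintegral_compProd hg, lintegral_map (by fun_prop) hf]
  rfl

lemma map_swap_compProd (m : Measure 𝓐) [IsProbabilityMeasure m]
    (κ : Kernel 𝓐 𝓑) [IsMarkovKernel κ] (η : Kernel 𝓐 𝓒) [IsMarkovKernel η] :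
    (m ⊗ₘ κ ⊗ₘ η.comap Prod.fst measurable_fst).map (fun p => ((p.1.1, p.2), p.1.2)) =
      m ⊗ₘ η ⊗ₘ κ.comap Prod.fst measurable_fst := by
  refine Measure.ext_of_lintegral _ fun g hg => ?_
  rw [lintegral_map hg (by fun_prop), Measure.lintegral_compProd (by fun_prop),
    Measure.lintegral_compProd hg, Measure.lintegral_compProd, Measure.lintegral_compProd]
  · refine lintegral_congr fun a => ?_
    simp only [Kernel.comap_apply]
    exact lintegral_lintegral_swap (by fun_prop)
  · exact Measurable.lintegral_kernel_prod_right' hg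
  · exact Measurable.lintegral_kernel_prod_right' (f := fun p : (𝓐 × 𝓑) × 𝓒 => g ((p.1.1, p.2), p.1.2))
      (by fun_prop)

lemma map_assoc_compProd_prod (m : Measure 𝓐) [IsProbabilityMeasure m]
    (κ : Kernel 𝓐 𝓑) [IsMarkovKernel κ] (η : Kernel 𝓐 𝓒) [IsMarkovKernel η] :
    (m ⊗ₘ (κ ×ₖ η)).map (fun p => ((p.1, p.2.1), p.2.2)) =
      m ⊗ₘ κ ⊗ₘ η.comap Prod.fst measurable_fst := by
  refine Measure.ext_of_lintegral _ fun g hg => ?_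
  rw [lintegral_map hg (by fun_prop), Measure.lintegral_compProd (by fun_prop),
    Measure.lintegral_compProd hg, Measure.lintegral_compProd]
  · refine lintegral_congr fun a => ?_
    rw [Kernel.prod_apply, lintegral_prod _ (by fun_prop)]
    rfl
  · exact Measurable.lintegral_kernel_prod_right' hg

lemma map_finSucc_compProd_kernelPi {n : ℕ} (m : Measure 𝓐) [IsProbabilityMeasure m]
    (κ : Fin (n + 1) → Kernel 𝓐 𝓑) [∀ i, IsMarkovKernel (κ i)] :
    (m ⊗ₘ kernelPi κ).map (fun p => ((p.1, fun j : Fin n => p.2 j.succ), p.2 0)) =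
      m ⊗ₘ kernelPi (fun j : Fin n => κ j.succ) ⊗ₘ (κ 0).comap Prod.fst measurable_fst := by
  refine Measure.ext_of_lintegral _ fun g hg => ?_
  have hm : Measurable (fun p : 𝓐 × (Fin (n + 1) → 𝓑) =>
      ((p.1, fun j : Fin n => p.2 j.succ), p.2 0)) := by fun_prop
  rw [lintegral_map hg hm, Measure.lintegral_compProd (by fun_prop),
    Measure.lintegral_compProd hg, Measure.lintegral_compProd]
  · refine lintegral_congr fun a => ?_
    simp only [kernelPi_apply, Kernel.comap_apply]
    have h := (measurePreserving_piFinSuccAbove (fun i => κ i a) 0).lintegral_comp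
      (f := fun q : 𝓑 × (Fin n → 𝓑) => g ((a, q.2), q.1)) (by fun_prop)
    refine Eq.trans ?_ (h.trans ?_)
    · rfl
    · rw [lintegral_prod_symm _ (by fun_prop)]
      rfl
  · exact Measurable.lintegral_kernel_prod_right' hg

end Kernels

open InformationTheory

/-! ### Kullback-Leibler divergence of kernels: chain rule and products -/

section Divergence

variable {𝓐 𝓑 𝓒 𝓓 : Type*} [MeasurableSpace 𝓐] [MeasurableSpace 𝓑] [MeasurableSpace 𝓒]
  [MeasurableSpace 𝓓]

lemma klDiv_map_of_leftInverse {f : 𝓐 → 𝓑} {g : 𝓑 → 𝓐} (hf : Measurable f) (hg : Measurable g)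
    (hgf : ∀ a, g (f a) = a) (μ ν : Measure 𝓐) [IsFiniteMeasure μ] [IsFiniteMeasure ν] :
    klDiv (μ.map f) (ν.map f) = klDiv μ ν := by
  refine le_antisymm (klDiv_map_le μ ν hf) ?_
  have h := klDiv_map_le (μ.map f) (ν.map f) hg
  have e : g ∘ f = id := funext hgf
  rwa [Measure.map_map hg hf, Measure.map_map hg hf, e, Measure.map_id, Measure.map_id] at h

lemma klDiv_compProd_comap_ge {f : 𝓐 → 𝓒} (hf : Measurable f) (m : Measure 𝓐)
    [IsProbabilityMeasure m] (κ η : Kernel 𝓒 𝓑) [IsMarkovKernel κ] [IsMarkovKernel η] :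
    klDiv (m.map f ⊗ₘ κ) (m.map f ⊗ₘ η) ≤ klDiv (m ⊗ₘ κ.comap f hf) (m ⊗ₘ η.comap f hf) := by
  rw [← map_compProd_comap hf, ← map_compProd_comap hf]
  exact klDiv_map_le _ _ (by fun_prop)

/-- Given `f a`, the points `a` and `b` are conditionally independent. So one may sample `f a`, then
`b` from `κ`, and only then recover `a` from its conditional law given `f a`, a kernel that does not
involve `κ`. -/
lemma compProd_comap_eq_map [StandardBorelSpace 𝓐] [Nonempty 𝓐] {f : 𝓐 → 𝓒} (hf : Measurable f)
    (m : Measure 𝓐) [IsProbabilityMeasure m] (κ : Kernel 𝓒 𝓑) [IsMarkovKernel κ] :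
    m ⊗ₘ κ.comap f hf =
      (m.map f ⊗ₘ κ ⊗ₘ (condDistrib id f m).comap Prod.fst measurable_fst).map
        (fun p => (p.2, p.1.2)) := by
  have : IsProbabilityMeasure (m.map f) := Measure.isProbabilityMeasure_map hf.aemeasurable
  have h := map_swap_compProd (m.map f) κ (condDistrib id f m)
  rw [compProd_map_condDistrib (by fun_prop)] at h
  have h2 := congrArg (Measure.map (fun p : (𝓒 × 𝓐) × 𝓑 => (p.1.2, p.2))) h
  rw [Measure.map_map (by fun_prop) (by fun_prop)] at h2
  refine Eq.trans ?_ h2.symm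
  refine Measure.ext_of_lintegral _ fun g hg => ?_
  rw [Measure.lintegral_compProd hg, lintegral_map hg (by fun_prop),
    Measure.lintegral_compProd (by fun_prop), lintegral_map _ (by fun_prop)]
  · rfl
  · exact Measurable.lintegral_kernel_prod_right' (f := fun p : (𝓒 × 𝓐) × 𝓑 => g (p.1.2, p.2))
      (by fun_prop)

/-- Converse of data processing: `f` is sufficient, because the same kernel recovers `a` from `f a`
under both measures, and appending a common kernel leaves the divergence unchanged. -/
lemma klDiv_compProd_comap_le [StandardBorelSpace 𝓐] {f : 𝓐 → 𝓒} (hf : Measurable f)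
    (m : Measure 𝓐) [IsProbabilityMeasure m] (κ η : Kernel 𝓒 𝓑) [IsMarkovKernel κ]
    [IsMarkovKernel η] :
    klDiv (m ⊗ₘ κ.comap f hf) (m ⊗ₘ η.comap f hf) ≤ klDiv (m.map f ⊗ₘ κ) (m.map f ⊗ₘ η) := by
  have : Nonempty 𝓐 := m.nonempty_of_neZero
  have : IsProbabilityMeasure (m.map f) := Measure.isProbabilityMeasure_map hf.aemeasurable
  rw [compProd_comap_eq_map hf m κ, compProd_comap_eq_map hf m η]
  refine (klDiv_map_le _ _ (by fun_prop)).trans ?_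
  rw [klDiv_compProd_left]

/-- Superadditivity of the divergence from a product kernel. -/
lemma sum_klDiv_le [StandardBorelSpace 𝓑] [Nonempty 𝓑] {Ω : Type*} [MeasurableSpace Ω]
    (μ : Measure Ω) [IsProbabilityMeasure μ] {C : Ω → 𝓐} (hC : Measurable C) {n : ℕ}
    {Z : Ω → Fin n → 𝓑} (hZ : Measurable Z) (κ : Fin n → Kernel 𝓐 𝓑) [∀ i, IsMarkovKernel (κ i)] :
    ∑ i, klDiv (μ.map fun ω => (C ω, Z ω i)) (μ.map C ⊗ₘ κ i) ≤
      klDiv (μ.map fun ω => (C ω, Z ω)) (μ.map C ⊗ₘ kernelPi κ) := by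
  have : IsProbabilityMeasure (μ.map C) := Measure.isProbabilityMeasure_map hC.aemeasurable
  induction n with
  | zero => simp
  | succ n ih =>
    have hZ' : Measurable fun ω => fun j : Fin n => Z ω j.succ := by fun_prop
    have hCZ : Measurable fun ω => (C ω, fun j : Fin n => Z ω j.succ) := by fun_prop
    have : IsProbabilityMeasure (μ.map fun ω => (C ω, fun j : Fin n => Z ω j.succ)) :=
      Measure.isProbabilityMeasure_map hCZ.aemeasurable
    have hm : Measurable (fun p : 𝓐 × (Fin (n + 1) → 𝓑) =>
      ((p.1, fun j : Fin n => p.2 j.succ), p.2 0)) := by fun_prop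
    refine le_trans ?_ (klDiv_map_le _ _ hm)
    rw [map_finSucc_compProd_kernelPi, Measure.map_map hm (by fun_prop), Fin.sum_univ_succ,
      add_comm]
    have e : μ.map ((fun p : 𝓐 × (Fin (n + 1) → 𝓑) =>
        ((p.1, fun j : Fin n => p.2 j.succ), p.2 0)) ∘ fun ω => (C ω, Z ω)) =
        μ.map (fun ω => (C ω, fun j : Fin n => Z ω j.succ)) ⊗ₘ
          condDistrib (fun ω => Z ω 0) (fun ω => (C ω, fun j : Fin n => Z ω j.succ)) μ := by
      rw [compProd_map_condDistrib (by fun_prop)]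
      rfl
    -- The chain rule splits off coordinate `0` given the tail. The tail is handled by induction; in
    -- the other term the reference `κ 0` ignores the tail, so forgetting the tail can only lower
    -- the divergence.
    rw [e, klDiv_compProd_eq_add]
    refine add_le_add (ih hZ' fun j => κ j.succ) ?_
    rw [compProd_map_condDistrib (by fun_prop)]
    have hm2 : Measurable (fun p : (𝓐 × (Fin n → 𝓑)) × 𝓑 => (p.1.1, p.2)) := by fun_prop
    refine le_trans (le_of_eq ?_) (klDiv_map_le _ _ hm2)
    rw [map_compProd_comap measurable_fst, Measure.map_map hm2 (by fun_prop),
      Measure.map_map measurable_fst hCZ]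
    rfl

/-- The divergence between product kernels is at most the sum of the divergences of the factors. -/
lemma klDiv_kernelPi_le [StandardBorelSpace 𝓐] [StandardBorelSpace 𝓑] (m : Measure 𝓐)
    [IsProbabilityMeasure m] {n : ℕ} (η κ : Fin n → Kernel 𝓐 𝓑)
    [∀ i, IsMarkovKernel (η i)] [∀ i, IsMarkovKernel (κ i)] :
    klDiv (m ⊗ₘ kernelPi η) (m ⊗ₘ kernelPi κ) ≤ ∑ i, klDiv (m ⊗ₘ η i) (m ⊗ₘ κ i) := by
  induction n with
  | zero =>
    have : kernelPi η = kernelPi κ := by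
      ext a : 1
      simp only [kernelPi_apply]
      congr 1
      exact funext fun i => i.elim0
    rw [this]
    simp
  | succ n ih =>
    have hm : Measurable (fun p : 𝓐 × (Fin (n + 1) → 𝓑) =>
      ((p.1, fun j : Fin n => p.2 j.succ), p.2 0)) := by fun_prop
    have hg : Measurable (fun q : (𝓐 × (Fin n → 𝓑)) × 𝓑 =>
        (q.1.1, (Fin.cons q.2 q.1.2 : Fin (n + 1) → 𝓑))) := by
      refine Measurable.prodMk (by fun_prop) (measurable_pi_lambda _ fun i => ?_)
      refine Fin.cases ?_ (fun j => ?_) i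
      · simpa using measurable_snd
      · simp only [Fin.cons_succ]; fun_prop
    rw [← klDiv_map_of_leftInverse hm hg, map_finSucc_compProd_kernelPi,
      map_finSucc_compProd_kernelPi, klDiv_compProd_eq_add, Fin.sum_univ_succ, add_comm]
    · refine add_le_add ?_ (ih _ _)
      -- Neither kernel for coordinate `0` looks at the tail, so conditioning on the tail adds
      -- nothing.
      refine (klDiv_compProd_comap_le _ _ _ _).trans (le_of_eq ?_)
      have : (m ⊗ₘ kernelPi fun j : Fin n => η j.succ).map Prod.fst = m :=
        Measure.fst_compProd _ _
      rw [this]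
    · rintro ⟨a, z⟩
      refine Prod.ext rfl (funext fun i => ?_)
      refine Fin.cases ?_ (fun j => ?_) i <;> simp

end Divergence

end QCI

namespace QCI

open InformationTheory

/-! ### Conditional mutual information and the golden formula -/

section MutualInformation

variable {Ω 𝓧 𝓨 𝓩 : Type*} [MeasurableSpace Ω] [MeasurableSpace 𝓧] [StandardBorelSpace 𝓧]
  [Nonempty 𝓧] [MeasurableSpace 𝓨] [StandardBorelSpace 𝓨] [Nonempty 𝓨] [MeasurableSpace 𝓩]
  {μ : Measure Ω} [IsProbabilityMeasure μ] {X : Ω → 𝓧} {Y : Ω → 𝓨} {Z : Ω → 𝓩}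

lemma condMutualInfo_eq_klDiv (hX : Measurable X) (hY : Measurable Y) (hZ : Measurable Z) :
    condMutualInfo X Y Z μ = klDiv (μ.map fun ω => ((Z ω, X ω), Y ω))
      ((μ.map fun ω => (Z ω, X ω)) ⊗ₘ (condDistrib Y Z μ).comap Prod.fst measurable_fst) := by
  have : IsProbabilityMeasure (μ.map Z) := Measure.isProbabilityMeasure_map hZ.aemeasurable
  have hm : Measurable (fun p : 𝓩 × 𝓧 × 𝓨 => ((p.1, p.2.1), p.2.2)) := by fun_prop
  have hg : Measurable (fun p : (𝓩 × 𝓧) × 𝓨 => (p.1.1, p.1.2, p.2)) := by fun_prop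
  rw [condMutualInfo, ← klDiv_map_of_leftInverse hm hg (fun _ => rfl), map_assoc_compProd_prod,
    compProd_map_condDistrib hX.aemeasurable, Measure.map_map hm (by fun_prop)]
  rfl

lemma condMutualInfo_comm (hX : Measurable X) (hY : Measurable Y) (hZ : Measurable Z) :
    condMutualInfo X Y Z μ = condMutualInfo Y X Z μ := by
  have : IsProbabilityMeasure (μ.map Z) := Measure.isProbabilityMeasure_map hZ.aemeasurable
  have hm : Measurable (fun p : (𝓩 × 𝓧) × 𝓨 => ((p.1.1, p.2), p.1.2)) := by fun_prop
  have hg : Measurable (fun p : (𝓩 × 𝓨) × 𝓧 => ((p.1.1, p.2), p.1.2)) := by fun_prop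
  rw [condMutualInfo_eq_klDiv hX hY hZ, condMutualInfo_eq_klDiv hY hX hZ,
    ← klDiv_map_of_leftInverse hm hg (fun _ => rfl), ← compProd_map_condDistrib hX.aemeasurable,
    map_swap_compProd, compProd_map_condDistrib hY.aemeasurable, Measure.map_map hm (by fun_prop)]
  rfl

/-- The golden formula for the conditional mutual information. -/
lemma klDiv_compProd_comap_fst_eq_add (hX : Measurable X) (hY : Measurable Y) (hZ : Measurable Z)
    (κ : Kernel 𝓩 𝓨) [IsMarkovKernel κ] :
    klDiv (μ.map fun ω => ((Z ω, X ω), Y ω))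
        ((μ.map fun ω => (Z ω, X ω)) ⊗ₘ κ.comap Prod.fst measurable_fst) =
      klDiv (μ.map fun ω => (Z ω, Y ω)) (μ.map Z ⊗ₘ κ) + condMutualInfo X Y Z μ := by
  have : IsProbabilityMeasure (μ.map Z) := Measure.isProbabilityMeasure_map hZ.aemeasurable
  have : IsProbabilityMeasure (μ.map fun ω => (Z ω, Y ω)) :=
    Measure.isProbabilityMeasure_map (by fun_prop)
  have hm : Measurable (fun p : (𝓩 × 𝓧) × 𝓨 => ((p.1.1, p.2), p.1.2)) := by fun_prop
  have hg : Measurable (fun p : (𝓩 × 𝓨) × 𝓧 => ((p.1.1, p.2), p.1.2)) := by fun_prop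
  rw [condMutualInfo_comm hX hY hZ, condMutualInfo_eq_klDiv hY hX hZ,
    ← klDiv_map_of_leftInverse hm hg (fun _ => rfl), ← compProd_map_condDistrib hX.aemeasurable,
    map_swap_compProd, Measure.map_map hm (by fun_prop)]
  have e : μ.map ((fun p : (𝓩 × 𝓧) × 𝓨 => ((p.1.1, p.2), p.1.2)) ∘ fun ω => ((Z ω, X ω), Y ω)) =
      μ.map (fun ω => (Z ω, Y ω)) ⊗ₘ condDistrib X (fun ω => (Z ω, Y ω)) μ := by
    rw [compProd_map_condDistrib (by fun_prop)]
    rfl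
  -- With `Y` sampled before `X`, both laws end with a kernel for `X`. The chain rule leaves the
  -- divergence of `Y` from `κ` and that of the law of `X` given `(Z, Y)` from its law given `Z`,
  -- which is the mutual information.
  rw [e, klDiv_compProd_eq_add, compProd_map_condDistrib (by fun_prop)]

lemma condMutualInfo_le_klDiv (hX : Measurable X) (hY : Measurable Y) (hZ : Measurable Z)
    (κ : Kernel 𝓩 𝓨) [IsMarkovKernel κ] :
    condMutualInfo X Y Z μ ≤ klDiv (μ.map fun ω => ((Z ω, X ω), Y ω))
      ((μ.map fun ω => (Z ω, X ω)) ⊗ₘ κ.comap Prod.fst measurable_fst) := by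
  rw [klDiv_compProd_comap_fst_eq_add hX hY hZ]
  exact le_add_self

lemma condMutualInfo_eq_klDiv_of_map_eq (hX : Measurable X) (hY : Measurable Y) (hZ : Measurable Z)
    {κ : Kernel 𝓩 𝓨} [IsMarkovKernel κ] (h : μ.map (fun ω => (Z ω, Y ω)) = μ.map Z ⊗ₘ κ) :
    condMutualInfo X Y Z μ = klDiv (μ.map fun ω => ((Z ω, X ω), Y ω))
      ((μ.map fun ω => (Z ω, X ω)) ⊗ₘ κ.comap Prod.fst measurable_fst) := by
  have : IsProbabilityMeasure (μ.map Z) := Measure.isProbabilityMeasure_map hZ.aemeasurable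
  rw [klDiv_compProd_comap_fst_eq_add hX hY hZ, h, klDiv_self, zero_add]

/-- Data processing: the image under `f` of the conditional law of `Y` is an admissible reference in
the golden formula. -/
lemma condMutualInfo_comp_right_le {𝓨' : Type*} [MeasurableSpace 𝓨'] [StandardBorelSpace 𝓨']
    [Nonempty 𝓨'] (hX : Measurable X) (hY : Measurable Y) (hZ : Measurable Z) {f : 𝓨 → 𝓨'}
    (hf : Measurable f) :
    condMutualInfo X (fun ω => f (Y ω)) Z μ ≤ condMutualInfo X Y Z μ := by
  have hm : Measurable (fun p : (𝓩 × 𝓧) × 𝓨 => (p.1, f p.2)) := by fun_prop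
  have : IsMarkovKernel ((condDistrib Y Z μ).map f) := Kernel.IsMarkovKernel.map _ hf
  refine (condMutualInfo_le_klDiv hX (by fun_prop) hZ ((condDistrib Y Z μ).map f)).trans ?_
  rw [condMutualInfo_eq_klDiv hX hY hZ]
  refine le_trans (le_of_eq ?_) (klDiv_map_le _ _ hm)
  rw [Measure.map_map hm (by fun_prop)]
  congr 1
  change _ = Measure.map (Prod.map id f) _
  rw [← Measure.compProd_map hf]
  congr 1
  ext a : 1
  rw [Kernel.comap_apply, Kernel.map_apply _ hf, Kernel.map_apply _ hf, Kernel.comap_apply]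

lemma condMutualInfo_comp_right {𝓨' : Type*} [MeasurableSpace 𝓨'] [StandardBorelSpace 𝓨']
    [Nonempty 𝓨'] (hX : Measurable X) (hY : Measurable Y) (hZ : Measurable Z) {f : 𝓨 → 𝓨'}
    (hf : Measurable f) {g : 𝓨' → 𝓨} (hg : Measurable g) (hgf : ∀ y, g (f y) = y) :
    condMutualInfo X (fun ω => f (Y ω)) Z μ = condMutualInfo X Y Z μ := by
  refine le_antisymm (condMutualInfo_comp_right_le hX hY hZ hf) ?_
  have h := condMutualInfo_comp_right_le (μ := μ) (Y := fun ω => f (Y ω)) hX (by fun_prop) hZ hg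
  simpa only [hgf] using h

/-- Only the joint law matters, which allows passing to a canonical probability space. Conditional
laws are determined only almost everywhere, so the reference measures are compared by an almost
everywhere congruence. -/
lemma condMutualInfo_comp {Ω' : Type*} [MeasurableSpace Ω'] {ν : Measure Ω'}
    [IsProbabilityMeasure ν] {E : Ω' → Ω} (hE : AEMeasurable E ν) (hX : Measurable X)
    (hY : Measurable Y) (hZ : Measurable Z) [IsProbabilityMeasure (ν.map E)] :
    condMutualInfo (fun ω => X (E ω)) (fun ω => Y (E ω)) (fun ω => Z (E ω)) ν =
      condMutualInfo X Y Z (ν.map E) := by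
  have hX' : condDistrib X Z (ν.map E) =ᵐ[(ν.map E).map Z]
      condDistrib (fun ω => X (E ω)) (fun ω => Z (E ω)) ν := by
    rw [AEMeasurable.map_map_of_aemeasurable hZ.aemeasurable hE]
    exact condDistrib_map hZ.aemeasurable hX.aemeasurable hE
  have hY' : condDistrib Y Z (ν.map E) =ᵐ[(ν.map E).map Z]
      condDistrib (fun ω => Y (E ω)) (fun ω => Z (E ω)) ν := by
    rw [AEMeasurable.map_map_of_aemeasurable hZ.aemeasurable hE]
    exact condDistrib_map hZ.aemeasurable hY.aemeasurable hE
  rw [condMutualInfo, condMutualInfo]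
  congr 1
  · rw [AEMeasurable.map_map_of_aemeasurable (by fun_prop) hE]
    rfl
  · have e : (ν.map E).map Z = ν.map (fun ω => Z (E ω)) :=
      AEMeasurable.map_map_of_aemeasurable hZ.aemeasurable hE
    rw [← e]
    refine Measure.compProd_congr ?_
    filter_upwards [hX', hY'] with z hz hz'
    rw [Kernel.prod_apply, Kernel.prod_apply, hz, hz']

end MutualInformation

/-! ### The two comparison principles -/

section Comparison

variable {Ω : Type*} [MeasurableSpace Ω] {μ : Measure Ω} [IsProbabilityMeasure μ]

/-- Two systems `(C, X, Z)` and `(C', X', Z')` in which the entries of `Z` are obtained from entries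
of `(C, X)` by the same memoryless channel, and whose entrywise laws agree. The conditional mutual
information is the largest when the entries of `Z` are conditionally independent given `C`. -/
lemma condMutualInfo_le_of_memoryless {𝓒 𝓧 𝓓 𝓔 β : Type*}
    [MeasurableSpace 𝓒] [StandardBorelSpace 𝓒]
    [MeasurableSpace 𝓧] [StandardBorelSpace 𝓧] [Nonempty 𝓧] [MeasurableSpace 𝓓]
    [MeasurableSpace 𝓔] [MeasurableSpace β] [StandardBorelSpace β] [Nonempty β] {n : ℕ}
    {C C' : Ω → 𝓒} {X X' : Ω → 𝓧} {Z Z' : Ω → Fin n → β}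
    (hC : Measurable C) (hC' : Measurable C') (hX : Measurable X) (hX' : Measurable X')
    (hZ : Measurable Z) (hZ' : Measurable Z')
    {f : Fin n → 𝓒 → 𝓓} (hf : ∀ i, Measurable (f i)) {p : Fin n → 𝓧 → 𝓔}
    (hp : ∀ i, Measurable (p i))
    (K : Fin n → Kernel (𝓓 × 𝓔) β) [∀ i, IsMarkovKernel (K i)]
    (Q : Fin n → Kernel 𝓓 β) [∀ i, IsMarkovKernel (Q i)]
    (hmem : μ.map (fun ω => ((C ω, X ω), Z ω)) = (μ.map fun ω => (C ω, X ω)) ⊗ₘ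
      kernelPi fun i => (K i).comap (Prod.map (f i) (p i)) ((hf i).prodMap (hp i)))
    (hmem' : μ.map (fun ω => ((C' ω, X' ω), Z' ω)) = (μ.map fun ω => (C' ω, X' ω)) ⊗ₘ
      kernelPi fun i => (K i).comap (Prod.map (f i) (p i)) ((hf i).prodMap (hp i)))
    (hind : μ.map (fun ω => (C' ω, Z' ω)) = μ.map C' ⊗ₘ
      kernelPi fun i => (Q i).comap (f i) (hf i))
    (hlaw : ∀ i, μ.map (fun ω => (f i (C ω), p i (X ω))) =
      μ.map fun ω => (f i (C' ω), p i (X' ω))) :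
    condMutualInfo X Z C μ ≤ condMutualInfo X' Z' C' μ := by
  have : IsProbabilityMeasure (μ.map fun ω => (C ω, X ω)) :=
    Measure.isProbabilityMeasure_map (by fun_prop)
  have : IsProbabilityMeasure (μ.map fun ω => (C' ω, X' ω)) :=
    Measure.isProbabilityMeasure_map (by fun_prop)
  have hcomap : ((kernelPi fun i => (Q i).comap (f i) (hf i)).comap Prod.fst measurable_fst :
        Kernel (𝓒 × 𝓧) (Fin n → β)) =
      kernelPi fun i => ((Q i).comap Prod.fst measurable_fst).comap (Prod.map (f i) (p i))
        ((hf i).prodMap (hp i)) := rfl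
  -- The reference built from `Q` is the true conditional law for the primed system only. There the
  -- golden formula is an equality; for the other system it gives an upper bound.
  refine (condMutualInfo_le_klDiv hX hZ hC (kernelPi fun i => (Q i).comap (f i) (hf i))).trans ?_
  rw [condMutualInfo_eq_klDiv_of_map_eq hX' hZ' hC' hind, hcomap, hmem]
  refine (klDiv_kernelPi_le _ _ _).trans ?_
  refine le_trans ?_ (sum_klDiv_le μ (hC'.prodMk hX') hZ' _)
  refine Finset.sum_le_sum fun i _ => ?_
  -- Both scalar kernels see `(C, X)` through `(f i, p i)` only, and `hlaw` says that this pair has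
  -- the same law in the two systems.
  refine (klDiv_compProd_comap_le _ _ _ _).trans ?_
  have hfp : Measurable (Prod.map (f i) (p i)) := (hf i).prodMap (hp i)
  have e : (μ.map fun ω => (C ω, X ω)).map (Prod.map (f i) (p i)) =
      (μ.map fun ω => (C' ω, X' ω)).map (Prod.map (f i) (p i)) := by
    rw [Measure.map_map hfp (by fun_prop), Measure.map_map hfp (by fun_prop)]
    exact hlaw i
  rw [e]
  refine (klDiv_compProd_comap_ge hfp _ _ _).trans (le_of_eq ?_)
  congr 1
  have hm : Measurable (fun q : (𝓒 × 𝓧) × (Fin n → β) => (q.1, q.2 i)) := by fun_prop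
  have h := congrArg (Measure.map fun q : (𝓒 × 𝓧) × (Fin n → β) => (q.1, q.2 i)) hmem'
  rw [Measure.map_map hm (by fun_prop)] at h
  refine Eq.trans ?_ h.symm
  change _ = Measure.map (Prod.map id fun z : Fin n → β => z i) _
  rw [← Measure.compProd_map (measurable_pi_apply i)]
  congr 1
  ext a : 1
  rw [Kernel.map_apply _ (measurable_pi_apply i), kernelPi_apply, Measure.pi_map_eval]
  simp

/-- Two observations `Z`, `Z'` of a vector `X` with independent entries given `L`, such that the
entrywise laws agree. The conditional mutual information is the least when the entries of `X` are
conditionally independent given the observation, each depending on its own entry of it. -/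
lemma condMutualInfo_le_of_independent {𝓛 𝓩 𝓔 β : Type*}
    [MeasurableSpace 𝓛] [StandardBorelSpace 𝓛]
    [MeasurableSpace 𝓩] [StandardBorelSpace 𝓩] [Nonempty 𝓩]
    [MeasurableSpace 𝓔] [MeasurableSpace β] [StandardBorelSpace β] [Nonempty β] {n : ℕ}
    {L : Ω → 𝓛} {X : Ω → Fin n → β} {Z Z' : Ω → 𝓩}
    (hL : Measurable L) (hX : Measurable X) (hZ : Measurable Z) (hZ' : Measurable Z')
    {r : Fin n → 𝓩 → 𝓔} (hr : ∀ i, Measurable (r i))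
    (π : Fin n → Kernel 𝓛 β) [∀ i, IsMarkovKernel (π i)]
    (R : Fin n → Kernel (𝓛 × 𝓔) β) [∀ i, IsMarkovKernel (R i)]
    (hprior : μ.map (fun ω => (L ω, X ω)) = μ.map L ⊗ₘ kernelPi π)
    (hpost : μ.map (fun ω => ((L ω, Z' ω), X ω)) = (μ.map fun ω => (L ω, Z' ω)) ⊗ₘ
      kernelPi fun i => (R i).comap (Prod.map id (r i)) (measurable_id.prodMap (hr i)))
    (hlaw : ∀ i, μ.map (fun ω => ((L ω, r i (Z ω)), X ω i)) =
      μ.map fun ω => ((L ω, r i (Z' ω)), X ω i)) :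
    condMutualInfo X Z' L μ ≤ condMutualInfo X Z L μ := by
  have : IsProbabilityMeasure (μ.map fun ω => (L ω, Z ω)) :=
    Measure.isProbabilityMeasure_map (by fun_prop)
  have : IsProbabilityMeasure (μ.map fun ω => (L ω, Z' ω)) :=
    Measure.isProbabilityMeasure_map (by fun_prop)
  have hcomap : ((kernelPi π).comap Prod.fst measurable_fst : Kernel (𝓛 × 𝓩) (Fin n → β)) =
      kernelPi fun i => ((π i).comap Prod.fst measurable_fst).comap (Prod.map id (r i))
        (measurable_id.prodMap (hr i)) := rfl
  -- With `X` in the role of the output, the same reference, the product prior, is exact for both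
  -- observations.
  rw [condMutualInfo_comm hX hZ' hL, condMutualInfo_comm hX hZ hL,
    condMutualInfo_eq_klDiv_of_map_eq hZ' hX hL hprior,
    condMutualInfo_eq_klDiv_of_map_eq hZ hX hL hprior, hcomap, hpost]
  refine (klDiv_kernelPi_le _ _ _).trans ?_
  refine le_trans ?_ (sum_klDiv_le μ (hL.prodMk hZ) hX _)
  refine Finset.sum_le_sum fun i _ => ?_
  refine (klDiv_compProd_comap_le _ _ _ _).trans ?_
  have hir : Measurable (Prod.map (id : 𝓛 → 𝓛) (r i)) := measurable_id.prodMap (hr i)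
  have hm : Measurable (fun q : (𝓛 × 𝓩) × (Fin n → β) => ((q.1.1, r i q.1.2), q.2 i)) := by
    fun_prop
  have h := congrArg (Measure.map fun q : (𝓛 × 𝓩) × (Fin n → β) => ((q.1.1, r i q.1.2), q.2 i))
    hpost
  have e1 : ((μ.map fun ω => (L ω, Z' ω)) ⊗ₘ kernelPi fun i => (R i).comap (Prod.map id (r i))
      (measurable_id.prodMap (hr i))).map (fun q => ((q.1.1, r i q.1.2), q.2 i)) =
      (μ.map fun ω => (L ω, Z' ω)).map (Prod.map id (r i)) ⊗ₘ R i := by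
    rw [← map_compProd_comap hir]
    have hev : (kernelPi fun i => (R i).comap (Prod.map id (r i))
        (measurable_id.prodMap (hr i))).map (Function.eval i) =
        (R i).comap (Prod.map id (r i)) hir := by
      ext a : 1
      rw [Kernel.map_apply _ (measurable_pi_apply i), kernelPi_apply, Measure.pi_map_eval]
      simp
    rw [← hev, Measure.compProd_map (measurable_pi_apply i), Measure.map_map (by fun_prop)
      (by fun_prop)]
    rfl
  rw [← e1, ← hpost, Measure.map_map hm (by fun_prop)]
  have hdom : (μ.map fun ω => (L ω, Z' ω)).map (Prod.map id (r i)) =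
      (μ.map fun ω => (L ω, Z ω)).map (Prod.map id (r i)) := by
    have h1 := congrArg (Measure.map Prod.fst) (hlaw i)
    rw [Measure.map_map measurable_fst (by fun_prop), Measure.map_map measurable_fst (by fun_prop)]
      at h1
    rw [Measure.map_map hir (by fun_prop), Measure.map_map hir (by fun_prop)]
    exact h1.symm
  rw [hdom, ← map_compProd_comap hir]
  have h2 : μ.map ((fun q : (𝓛 × 𝓩) × (Fin n → β) => ((q.1.1, r i q.1.2), q.2 i)) ∘
      fun ω => ((L ω, Z' ω), X ω)) =
      (μ.map fun ω => ((L ω, Z ω), X ω i)).map (fun p => (Prod.map id (r i) p.1, p.2)) := by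
    rw [Measure.map_map (by fun_prop) (by fun_prop)]
    exact (hlaw i).symm
  rw [h2]
  -- For `Z` the posterior of `X i` may depend on all of `Z`; reducing `Z` to `r i` is data
  -- processing, in the direction needed.
  exact klDiv_map_le _ _ (by fun_prop)

end Comparison

/-! ### Disintegration of conditionally independent pairs -/

section Disintegration

/-- Independent pairs may be sampled by drawing all first components and then all second ones. On
boxes this is the product rule for expectations of independent factors. -/
lemma pi_compProd {α β : Type*} [MeasurableSpace α] [MeasurableSpace β] {n : ℕ}
    (m : Fin n → Measure α) [∀ i, IsProbabilityMeasure (m i)] (κ : Fin n → Kernel α β)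
    [∀ i, IsMarkovKernel (κ i)] :
    Measure.pi (fun i => m i ⊗ₘ κ i) =
      (Measure.pi m ⊗ₘ kernelPi fun i => (κ i).comap (fun a : Fin n → α => a i)
        (measurable_pi_apply i)).map (fun p i => (p.1 i, p.2 i)) := by
  refine Measure.pi_eq fun s hs => ?_
  have hm : Measurable (fun (p : (Fin n → α) × (Fin n → β)) i => (p.1 i, p.2 i)) := by fun_prop
  rw [Measure.map_apply hm (MeasurableSet.univ_pi hs),
    Measure.compProd_apply (hm (MeasurableSet.univ_pi hs))]
  have : ∀ a : Fin n → α, (kernelPi fun i => (κ i).comap (fun a : Fin n → α => a i)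
      (measurable_pi_apply i)) a (Prod.mk a ⁻¹' ((fun (p : (Fin n → α) × (Fin n → β)) i =>
        (p.1 i, p.2 i)) ⁻¹' Set.univ.pi s)) = ∏ i, κ i (a i) (Prod.mk (a i) ⁻¹' s i) := by
    intro a
    rw [kernelPi_apply, ← Measure.pi_pi]
    rfl
  simp_rw [this]
  have hκ : ∀ i, Measurable fun a => κ i a (Prod.mk a ⁻¹' s i) := fun i =>
    Kernel.measurable_kernel_prodMk_left (hs i)
  have hind := iIndepFun_pi (μ := m) (X := fun i a => κ i a (Prod.mk a ⁻¹' s i))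
    fun i => (hκ i).aemeasurable
  have := lintegral_prod_eq_prod_lintegral_of_indepFun Finset.univ
    (fun i (a : Fin n → α) => κ i (a i) (Prod.mk (a i) ⁻¹' s i)) hind
    fun i => (hκ i).comp (measurable_pi_apply i)
  rw [this]
  refine Finset.prod_congr rfl fun i _ => ?_
  rw [Measure.compProd_apply (hs i), ← lintegral_map (hκ i) (measurable_pi_apply i)]
  congr 1
  exact (measurePreserving_eval m i).map_eq

/-- If pairs `(A i, B i)` are conditionally independent given `L`, then so are the `B i` given
`(L, A)`, and the conditional law of `B i` depends on `A` through `A i` only. -/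
lemma map_pair_eq_compProd_condKernel {Ω 𝓛 α β : Type*} [MeasurableSpace Ω] {μ : Measure Ω}
    [IsProbabilityMeasure μ] [MeasurableSpace 𝓛] [MeasurableSpace α]
    [StandardBorelSpace α] [MeasurableSpace β]
    [StandardBorelSpace β] [Nonempty β] {n : ℕ} {L : Ω → 𝓛} (hL : Measurable L)
    {A : Ω → Fin n → α} (hA : Measurable A) {B : Ω → Fin n → β} (hB : Measurable B)
    (ρ : Fin n → Kernel 𝓛 (α × β)) [∀ i, IsMarkovKernel (ρ i)]
    (h : μ.map (fun ω => (L ω, fun i => (A ω i, B ω i))) = μ.map L ⊗ₘ kernelPi ρ) :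
    μ.map (fun ω => ((L ω, A ω), B ω)) = (μ.map fun ω => (L ω, A ω)) ⊗ₘ
      kernelPi fun i => (ρ i).condKernel.comap (fun q : 𝓛 × (Fin n → α) => (q.1, q.2 i))
        (by fun_prop) := by
  have : IsProbabilityMeasure (μ.map L) := Measure.isProbabilityMeasure_map hL.aemeasurable
  -- For each fixed `l`, disintegrate every pair and collect the first components in front.
  have hfib : ∀ l, kernelPi ρ l = (Measure.pi (fun i => (ρ i).fst l) ⊗ₘ
      kernelPi fun i => ((ρ i).condKernel.comap (Prod.mk l) measurable_prodMk_left).comap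
        (fun a : Fin n → α => a i) (measurable_pi_apply i)).map
      (fun p i => (p.1 i, p.2 i)) := by
    intro l
    rw [← pi_compProd, kernelPi_apply]
    congr 1
    funext i
    conv_lhs => rw [← (ρ i).disintegrate (ρ i).condKernel]
    rw [Kernel.compProd_apply_eq_compProd_sectR]
    rfl
  have hA' : μ.map (fun ω => (L ω, A ω)) = μ.map L ⊗ₘ kernelPi fun i => (ρ i).fst := by
    have hm : Measurable (fun p : 𝓛 × (Fin n → α × β) => (p.1, fun i => (p.2 i).1)) := by fun_prop
    have h' := congrArg (Measure.map fun p : 𝓛 × (Fin n → α × β) => (p.1, fun i => (p.2 i).1)) h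
    rw [Measure.map_map hm (by fun_prop)] at h'
    refine Eq.trans h' ?_
    change Measure.map (Prod.map id fun (v : Fin n → α × β) i => (v i).1) _ = _
    rw [← Measure.compProd_map (by fun_prop)]
    congr 1
    ext l : 1
    rw [Kernel.map_apply _ (by fun_prop), kernelPi_apply, kernelPi_apply,
      Measure.pi_map_pi (f := fun _ => Prod.fst) (fun _ => measurable_fst.aemeasurable)]
    congr 1
  have hm : Measurable (fun p : 𝓛 × (Fin n → α × β) =>
      ((p.1, fun i => (p.2 i).1), fun i => (p.2 i).2)) := by fun_prop
  have h' := congrArg (Measure.map fun p : 𝓛 × (Fin n → α × β) =>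
      ((p.1, fun i => (p.2 i).1), fun i => (p.2 i).2)) h
  rw [Measure.map_map hm (by fun_prop)] at h'
  refine Eq.trans h' ?_
  rw [hA']
  refine Measure.ext_of_lintegral _ fun g hg => ?_
  rw [lintegral_map hg hm, Measure.lintegral_compProd (by fun_prop),
    Measure.lintegral_compProd hg, Measure.lintegral_compProd]
  · refine lintegral_congr fun l => ?_
    rw [hfib l, lintegral_map (by fun_prop) (by fun_prop),
      Measure.lintegral_compProd (by fun_prop)]
    rfl
  · exact Measurable.lintegral_kernel_prod_right' hg

end Disintegration

/-! ### Independence of disjoint blocks of coordinates -/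

section Blocks

/-- Reading coordinate `l` from the independent copy numbered `b l` does not change the joint law.
Functions of different blocks then become functions of different copies, which makes their
independence explicit. -/
lemma map_resample {ι κ E : Type*} [Fintype ι] [Fintype κ] [MeasurableSpace E]
    (ν : ι → Measure E) [∀ l, IsProbabilityMeasure (ν l)] (b : ι → κ) :
    (Measure.pi fun _ : κ => Measure.pi ν).map (fun w l => w (b l) l) = Measure.pi ν := by
  classical
  refine (Measure.pi_eq fun s hs => ?_).symm
  rw [Measure.map_apply (by fun_prop) (MeasurableSet.univ_pi hs)]
  have e : (fun (w : κ → ι → E) l => w (b l) l) ⁻¹' Set.univ.pi s =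
      Set.univ.pi fun k => Set.univ.pi fun l => if b l = k then s l else Set.univ := by
    ext w
    simp only [Set.mem_preimage, Set.mem_pi, Set.mem_univ, true_implies]
    refine ⟨fun h k l => ?_, fun h l => by simpa using h (b l) l⟩
    split_ifs with hk
    · exact hk ▸ h l
    · trivial
  rw [e, Measure.pi_pi]
  simp_rw [Measure.pi_pi]
  rw [Finset.prod_comm]
  refine Finset.prod_congr rfl fun l _ => ?_
  rw [Finset.prod_eq_single (b l)]
  · simp
  · intro k _ hk
    rw [if_neg (Ne.symm hk), measure_univ]
  · simp

/-- Functions of disjoint blocks of independent coordinates, one of which also enters the functions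
of the other blocks. -/
lemma map_blocks_eq_compProd {ι κ E 𝓨 γ : Type*} [Fintype ι] [Fintype κ]
    [MeasurableSpace E] [MeasurableSpace 𝓨] [MeasurableSpace γ] (ν : ι → Measure E)
    [∀ l, IsProbabilityMeasure (ν l)] (b : ι → Option κ) {F : (ι → E) → 𝓨} (hF : Measurable F)
    (hFb : ∀ ω ω', (∀ l, b l = none → ω l = ω' l) → F ω = F ω')
    {φ : κ → 𝓨 × (ι → E) → γ} (hφ : ∀ k, Measurable (φ k))
    (hφb : ∀ k y ω ω', (∀ l, b l = some k → ω l = ω' l) → φ k (y, ω) = φ k (y, ω'))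
    [∀ k, IsMarkovKernel (paramKernel (φ k) (Measure.pi ν))] :
    (Measure.pi ν).map (fun ω => (F ω, fun k => φ k (F ω, ω))) =
      (Measure.pi ν).map F ⊗ₘ kernelPi fun k => paramKernel (φ k) (Measure.pi ν) := by
  have hG : Measurable fun ω => (F ω, fun k => φ k (F ω, ω)) := by fun_prop
  have hΦ : Measurable (fun (p : 𝓨 × (κ → ι → E)) k => φ k (p.1, p.2 k)) :=
    measurable_pi_lambda _ fun k => (hφ k).comp (by fun_prop)
  have hT : Measurable (fun (w : Option κ → ι → E) l => w (b l) l) := by fun_prop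
  have hker : kernelPi (fun k => paramKernel (φ k) (Measure.pi ν)) =
      paramKernel (fun (p : 𝓨 × (κ → ι → E)) k => φ k (p.1, p.2 k))
        (Measure.pi fun _ => Measure.pi ν) := by
    ext y : 1
    rw [paramKernel_apply hΦ, kernelPi_apply, Measure.pi_map_pi (f := fun k ω => φ k (y, ω))]
    · congr 1
      funext k
      exact paramKernel_apply (hφ k) _ _
    · exact fun k => ((hφ k).comp measurable_prodMk_left).aemeasurable
  rw [hker, ← map_prod_eq_compProd_paramKernel hF hΦ]
  -- One copy for each block: `F` reads the copy `none`, and `φ k` reads `F` and the copy `some k`.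
  conv_lhs => rw [← map_resample ν b]
  rw [Measure.map_map hG hT, ← Measure.pi_map_piOptionEquivProd (fun _ => Measure.pi ν),
    Measure.map_map (hG.comp hT) (MeasurableEquiv.measurable _), ← Measure.prod_swap,
    Measure.map_map ((hG.comp hT).comp (MeasurableEquiv.measurable _)) measurable_swap]
  congr 1
  funext p
  have hp0 : F (fun l => (MeasurableEquiv.piOptionEquivProd fun _ : Option κ => ι → E).symm p.swap
      (b l) l) = F p.1 := by
    refine hFb _ _ fun l hl => ?_
    rw [hl]
    rfl
  refine Prod.ext hp0 (funext fun k => ?_)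
  simp only [Function.comp_apply]
  rw [hp0]
  refine hφb _ _ _ _ fun l hl => ?_
  rw [hl]
  rfl

end Blocks

end QCI

namespace QCI

/-! ### Circularly symmetric complex Gaussians -/

section Gaussian

lemma measurable_complex_mk : Measurable fun p : ℝ × ℝ => (⟨p.1, p.2⟩ : ℂ) :=
  Complex.measurableEquivRealProd.symm.measurable

instance (v : ℝ≥0) : IsProbabilityMeasure (complexGaussian v) :=
  Measure.isProbabilityMeasure_map measurable_complex_mk.aemeasurable

lemma nullSingletonClass_complexGaussian {v : ℝ≥0} (hv : v ≠ 0) :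
    NullSingletonClass (complexGaussian v) := by
  have : NullSingletonClass (gaussianReal 0 (v / 2)) :=
    nullSingletonClass_gaussianReal (by simpa using hv)
  refine ⟨fun z => ?_⟩
  rw [complexGaussian, Measure.map_apply measurable_complex_mk (measurableSet_singleton z)]
  refine measure_mono_null (t := {(z.re, z.im)}) ?_ (measure_singleton _)
  rintro p hp
  simp only [Set.mem_preimage, Set.mem_singleton_iff] at hp
  simp [← hp]

lemma charFun_complexGaussian (v : ℝ≥0) (t : ℂ) :
    charFun (complexGaussian v) t = Complex.exp (-(v * ‖t‖ ^ 2 / 4 : ℝ)) := by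
  have hf : ∀ x : ℂ, Complex.exp ((inner ℝ x t : ℝ) * Complex.I) =
      Complex.exp (t.re * x.re * Complex.I) * Complex.exp (t.im * x.im * Complex.I) := by
    intro x
    rw [← Complex.exp_add, Complex.inner]
    congr 1
    simp only [Complex.mul_re, Complex.conj_re, Complex.conj_im, Complex.ofReal_sub,
      Complex.ofReal_mul, Complex.ofReal_neg]
    ring
  rw [charFun_apply, complexGaussian, integral_map measurable_complex_mk.aemeasurable]
  · simp_rw [hf]
    rw [integral_prod_mul (fun x : ℝ => Complex.exp (t.re * x * Complex.I))
      (fun x : ℝ => Complex.exp (t.im * x * Complex.I)), ← charFun_apply_real, ← charFun_apply_real,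
      charFun_gaussianReal, charFun_gaussianReal, ← Complex.exp_add]
    congr 1
    rw [← Complex.normSq_eq_norm_sq, Complex.normSq_apply]
    push_cast
    ring
  · exact Measurable.aestronglyMeasurable (by fun_prop)

/-- Linear combinations of independent circularly symmetric Gaussians. -/
lemma map_sum_complexGaussian {Ω ι : Type*} [MeasurableSpace Ω] {μ : Measure Ω} [Fintype ι]
    {X : ι → Ω → ℂ} (hX : ∀ i, Measurable (X i)) (hind : iIndepFun X μ) {v : ι → ℝ≥0}
    (hlaw : ∀ i, μ.map (X i) = complexGaussian (v i)) (c : ι → ℂ) :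
    μ.map (fun ω => ∑ i, c i * X i ω) = complexGaussian (∑ i, ‖c i‖₊ ^ 2 * v i) := by
  have := hind.isProbabilityMeasure
  have : IsProbabilityMeasure (μ.map fun ω => ∑ i, c i * X i ω) :=
    Measure.isProbabilityMeasure_map (by fun_prop)
  refine Measure.ext_of_charFun (funext fun t => ?_)
  rw [iIndepFun.charFun_map_fun_sum_eq_prod (X := fun i ω => c i * X i ω) (fun i => by fun_prop)
    (hind.comp (fun i z => c i * z) fun i => by fun_prop), Finset.prod_apply,
    charFun_complexGaussian]
  have h : ∀ i, charFun (μ.map fun ω => c i * X i ω) t =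
      Complex.exp (-((v i : ℝ) * ‖(starRingEnd ℂ) (c i) * t‖ ^ 2 / 4 : ℝ)) := by
    intro i
    rw [← charFun_complexGaussian, ← hlaw i, charFun_apply, charFun_apply,
      integral_map (by fun_prop) (Measurable.aestronglyMeasurable (by fun_prop)),
      integral_map (by fun_prop) (Measurable.aestronglyMeasurable (by fun_prop))]
    refine integral_congr_ae (Filter.Eventually.of_forall fun ω => ?_)
    simp only [Complex.inner, map_mul]
    congr 4
    ring
  rw [Finset.prod_congr rfl fun i _ => h i, ← Complex.exp_sum]
  congr 1
  push_cast
  rw [Finset.sum_neg_distrib, Finset.sum_mul, Finset.sum_div]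
  congr 1
  refine Finset.sum_congr rfl fun i _ => ?_
  simp only [norm_mul, RCLike.norm_conj, Complex.ofReal_mul]
  ring

end Gaussian

/-! ### Zero sets of polynomials are null -/

section Polynomial

/-- View `p` as a polynomial in the first variable. By induction its leading coefficient is almost
surely nonzero at the other variables; then there are finitely many roots, and an atomless law gives
them no mass. -/
lemma ae_eval_ne_zero_fin {n : ℕ} {ν : Fin n → Measure ℂ} [∀ i, IsProbabilityMeasure (ν i)]
    [∀ i, NullSingletonClass (ν i)] {p : MvPolynomial (Fin n) ℂ} (hp : p ≠ 0) :
    ∀ᵐ x ∂Measure.pi ν, MvPolynomial.eval x p ≠ 0 := by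
  induction n with
  | zero =>
    refine Filter.Eventually.of_forall fun x hx => hp ?_
    rw [MvPolynomial.eq_C_of_isEmpty p] at hx ⊢
    rw [MvPolynomial.eval_C] at hx
    rw [hx, map_zero]
  | succ n ih =>
    have hq : MvPolynomial.finSuccEquiv ℂ n p ≠ 0 := by simpa using hp
    have hcoef := ih (ν := fun i => ν i.succ) (Polynomial.leadingCoeff_ne_zero.mpr hq)
    have hmeas : MeasurableSet {z : ℂ × (Fin n → ℂ) |
        MvPolynomial.eval (Fin.cons z.1 z.2 : Fin (n + 1) → ℂ) p ≠ 0} := by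
      have hc : Continuous fun z : ℂ × (Fin n → ℂ) =>
          MvPolynomial.eval (Fin.cons z.1 z.2 : Fin (n + 1) → ℂ) p :=
        (MvPolynomial.continuous_eval p).comp (by fun_prop)
      exact (isOpen_ne_fun hc continuous_const).measurableSet
    have hprod : ∀ᵐ z ∂(ν 0).prod (Measure.pi fun i : Fin n => ν i.succ),
        MvPolynomial.eval (Fin.cons z.1 z.2 : Fin (n + 1) → ℂ) p ≠ 0 := by
      rw [Measure.ae_prod_iff_ae_ae hmeas, Measure.ae_ae_comm hmeas]
      filter_upwards [hcoef] with s hs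
      simp only [MvPolynomial.eval_eq_eval_mv_eval']
      have hq' : Polynomial.map (MvPolynomial.eval s) (MvPolynomial.finSuccEquiv ℂ n p) ≠ 0 := by
        intro h0
        apply hs
        have := congrArg (fun r => r.coeff (MvPolynomial.finSuccEquiv ℂ n p).natDegree) h0
        simpa [Polynomial.coeff_map] using this
      rw [ae_iff]
      simp only [ne_eq, not_not]
      exact (Polynomial.finite_setOfPred_isRoot hq').measure_zero (ν 0)
    have hmp := measurePreserving_piFinSuccAbove ν 0
    filter_upwards [hmp.quasiMeasurePreserving.ae hprod] with x hx
    convert hx using 3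
    exact (Fin.cons_self_tail x).symm

lemma ae_eval_ne_zero {ι : Type*} [Fintype ι] {ν : ι → Measure ℂ}
    [∀ i, IsProbabilityMeasure (ν i)] [∀ i, NullSingletonClass (ν i)] {p : MvPolynomial ι ℂ}
    (hp : p ≠ 0) : ∀ᵐ x ∂Measure.pi ν, MvPolynomial.eval x p ≠ 0 := by
  let e := (Fintype.equivFin ι).symm
  have hp' : MvPolynomial.rename e.symm p ≠ 0 := by
    simpa using (MvPolynomial.rename_injective e.symm e.symm.injective).ne hp
  have h := ae_eval_ne_zero_fin (ν := fun i => ν (e i)) hp'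
  have hmp := measurePreserving_piCongrLeft ν e
  have hmeas : MeasurableSet {x : ι → ℂ | MvPolynomial.eval x p ≠ 0} :=
    (isOpen_ne_fun (MvPolynomial.continuous_eval p) continuous_const).measurableSet
  rw [← hmp.map_eq, ae_map_iff hmp.measurable.aemeasurable hmeas]
  filter_upwards [h] with x hx
  rw [MvPolynomial.eval_rename] at hx
  convert hx using 3
  funext l
  obtain ⟨i, rfl⟩ := e.surjective l
  rw [MeasurableEquiv.piCongrLeft_apply_apply]
  simp

end Polynomial

end QCI

namespace QCI

/-! ### The quantization grid and the noise map -/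

section Grid

lemma gridCeil_mem {B : Finset ℝ≥0∞} (hB : ∞ ∈ B) (a : ℝ≥0∞) : gridCeil B a ∈ B := by
  have hne : (B.filter fun b => a ≤ b).Nonempty := ⟨∞, by simp [hB]⟩
  obtain ⟨b, hb, h⟩ := Finset.exists_mem_eq_inf _ hne id
  rw [gridCeil, h]
  exact (Finset.mem_filter.mp hb).1

lemma le_gridCeil (B : Finset ℝ≥0∞) (a : ℝ≥0∞) : a ≤ gridCeil B a :=
  Finset.le_inf fun _ hb => (Finset.mem_filter.mp hb).2

@[fun_prop]
lemma measurable_gridCeil (B : Finset ℝ≥0∞) : Measurable (gridCeil B) := by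
  refine Monotone.measurable fun a a' h => Finset.inf_mono fun b hb => ?_
  rw [Finset.mem_filter] at hb ⊢
  exact ⟨hb.1, h.trans hb.2⟩

@[fun_prop]
lemma measurable_addNoise {α : Type*} [MeasurableSpace α] {v : α → ℝ≥0∞} {u g : α → ℂ}
    (hv : Measurable v) (hu : Measurable u) (hg : Measurable g) :
    Measurable fun a => addNoise (v a) (u a) (g a) := by
  unfold addNoise
  refine Measurable.ite (hv (measurableSet_singleton ∞)) measurable_const ?_
  have : Measurable fun a => ((Real.sqrt (v a).toReal : ℝ) : ℂ) :=
    Complex.measurable_ofReal.comp (hv.ennreal_toReal.sqrt)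
  fun_prop

/-- The compression variances are arbitrary functions of the levels, but the levels take finitely
many values, so a measurable modification suffices. -/
lemma exists_measurable_eqOn_finite {α β : Type*} [MeasurableSpace α] [MeasurableSingletonClass α]
    [MeasurableSpace β] [Nonempty β] {S : Set α} (hS : S.Finite) (f : α → β) :
    ∃ f' : α → β, Measurable f' ∧ ∀ a ∈ S, f' a = f a := by
  classical
  obtain ⟨c⟩ := ‹Nonempty β›
  refine ⟨fun a => if a ∈ S then f a else c, fun t _ => ?_, fun a ha => if_pos ha⟩
  have e : (fun a => if a ∈ S then f a else c) ⁻¹' t = (S ∩ f ⁻¹' t) ∪ (Sᶜ ∩ {_a | c ∈ t}) := by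
    ext a
    by_cases ha : a ∈ S <;> simp [ha]
  rw [e]
  exact ((hS.subset Set.inter_subset_left).measurableSet).union
    (hS.measurableSet.compl.inter (MeasurableSet.const _))

end Grid

/-! ### The canonical space of all scalar entries -/

section Canonical

variable {M : ℕ} {N : Fin 2 → ℕ}

instance : Finite (Label M N) := by
  let f : Label M N → (Fin M ⊕ (Σ k, Fin (N k) × Fin M)) ⊕ (Σ k, Fin (N k)) ⊕
      (Fin 2 × Fin M) ⊕ (Fin 2 × Fin M) ⊕ (Fin 2 × Fin M) := fun l => match l with
    | .x i => .inl (.inl i)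
    | .H k j i => .inl (.inr ⟨k, j, i⟩)
    | .n k j => .inr (.inl ⟨k, j⟩)
    | .gArt k i => .inr (.inr (.inl (k, i)))
    | .gSur k i => .inr (.inr (.inr (.inl (k, i))))
    | .gCmp k i => .inr (.inr (.inr (.inr (k, i))))
  refine Finite.of_injective f fun l l' h => ?_
  cases l <;> cases l' <;> simp_all [f]
  obtain ⟨rfl, h⟩ := h
  simpa using h

noncomputable instance : Fintype (Label M N) := Fintype.ofFinite _

variable (M N) in
/-- The primitive random variables as coordinates on the space of all their values. -/
def coord : Variables (Label M N → ℂ) M N where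
  x ω i := ω (.x i)
  H k ω := fun j i => ω (.H k j i)
  n k ω j := ω (.n k j)
  gArt k ω i := ω (.gArt k i)
  gSur k ω i := ω (.gSur k i)
  gCmp k ω i := ω (.gCmp k i)

/-- The law of the entry with a given label. -/
noncomputable def labelLaw (σ : ℝ≥0) : Label M N → Measure ℂ
  | .n _ _ => complexGaussian (σ ^ 2)
  | _ => complexGaussian 1

instance (σ : ℝ≥0) (l : Label M N) : IsProbabilityMeasure (labelLaw σ l) := by
  cases l <;> (unfold labelLaw; infer_instance)

lemma nullSingletonClass_labelLaw {σ : ℝ≥0} (hσ : 0 < σ) (l : Label M N) :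
    NullSingletonClass (labelLaw σ l) := by
  cases l <;> exact nullSingletonClass_complexGaussian (by simp [hσ.ne'])

/-- The joint law of all the primitive random variables. -/
noncomputable abbrev canonicalLaw (M : ℕ) (N : Fin 2 → ℕ) (σ : ℝ≥0) : Measure (Label M N → ℂ) :=
  Measure.pi (labelLaw σ)

lemma Variables.IsGaussian.map_entry_eq {Ω : Type*} [MeasurableSpace Ω] {μ : Measure Ω}
    {V : Variables Ω M N} {σ : ℝ≥0} (hV : V.IsGaussian σ μ) :
    AEMeasurable (fun ω l => V.entry l ω) μ ∧
      μ.map (fun ω l => V.entry l ω) = canonicalLaw M N σ := by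
  have := hV.indep.isProbabilityMeasure
  have hl : ∀ l, HasLaw (V.entry l) (labelLaw σ l) μ := by
    intro l
    cases l with
    | x i => exact hV.law_x i
    | H k j i => exact hV.law_H k j i
    | n k j => exact hV.law_n k j
    | gArt k i => exact hV.law_gArt k i
    | gSur k i => exact hV.law_gSur k i
    | gCmp k i => exact hV.law_gCmp k i
  refine ⟨aemeasurable_pi_lambda _ fun l => (hl l).aemeasurable, ?_⟩
  rw [(iIndepFun_iff_map_fun_eq_pi_map fun l => (hl l).aemeasurable).mp hV.indep]
  congr 1
  funext l
  exact (hl l).map_eq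

/-- The Gram matrix of a channel. -/
noncomputable def gram (k : Fin 2) (ω : Label M N → ℂ) : Matrix (Fin M) (Fin M) ℂ :=
  ((coord M N).H k ω)ᴴ * (coord M N).H k ω

lemma continuous_gram (k : Fin 2) : Continuous (gram k : (Label M N → ℂ) → _) := by
  have : Continuous fun ω => (coord M N).H k ω := by
    refine continuous_matrix fun j i => ?_
    exact continuous_apply _
  exact this.matrix_conjTranspose.matrix_mul this

@[fun_prop]
lemma measurable_gram_inv (k : Fin 2) (i j : Fin M) :
    Measurable fun ω : Label M N → ℂ => (gram k ω)⁻¹ i j := by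
  -- The adjugate formula also covers singular matrices, where the inverse is zero by convention, so
  -- measurability holds everywhere.
  simp only [Matrix.inv_def, Matrix.smul_apply, Ring.inverse_eq_inv', smul_eq_mul]
  have h1 : Measurable fun ω : Label M N → ℂ => (gram k ω).det :=
    (continuous_gram k).matrix_det.measurable
  have h2 : Measurable fun ω : Label M N → ℂ => (gram k ω).adjugate i j :=
    ((continuous_gram k).matrix_adjugate.matrix_elem i j).measurable
  fun_prop

variable (σ : ℝ≥0) (B : Finset ℝ≥0∞) (s : Fin 2 → (Fin M → ℝ≥0∞) → Fin M → ℝ≥0∞)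

@[fun_prop]
lemma measurable_coord_a (k : Fin 2) (i : Fin M) :
    Measurable fun ω => (coord M N).a σ k ω i := by
  have : Measurable fun ω : Label M N → ℂ => ((σ : ℂ) ^ 2 * (gram k ω)⁻¹ i i).re := by fun_prop
  exact this.ennreal_ofReal

@[fun_prop]
lemma measurable_coord_level (k : Fin 2) : Measurable fun ω => (coord M N).level σ B k ω := by
  refine measurable_pi_lambda _ fun i => ?_
  exact (measurable_gridCeil B).comp (measurable_coord_a σ k i)

@[fun_prop]
lemma measurable_coord_levels : Measurable fun ω => (coord M N).levels σ B ω :=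
  measurable_pi_lambda _ fun k => measurable_coord_level σ B k

/-- The zero-forcing estimate with the receiver noise taken from a second argument. -/
noncomputable def zeroForcing (k : Fin 2) (y ω : Label M N → ℂ) : Fin M → ℂ :=
  ((gram k y)⁻¹ * ((coord M N).H k y)ᴴ) *ᵥ
    ((coord M N).H k y *ᵥ (coord M N).x y + (coord M N).n k ω)

lemma measurable_zeroForcing (k : Fin 2) (i : Fin M) :
    Measurable fun p : (Label M N → ℂ) × (Label M N → ℂ) => zeroForcing k p.1 p.2 i := by
  have hG : ∀ j, Measurable fun p : (Label M N → ℂ) × (Label M N → ℂ) => (gram k p.1)⁻¹ i j :=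
    fun j => (measurable_gram_inv k i j).comp measurable_fst
  have hH : ∀ j l, Measurable fun p : (Label M N → ℂ) × (Label M N → ℂ) =>
      (coord M N).H k p.1 j l := fun j l => (measurable_pi_apply (Label.H k j l)).comp measurable_fst
  have hx : ∀ l, Measurable fun p : (Label M N → ℂ) × (Label M N → ℂ) => (coord M N).x p.1 l :=
    fun l => (measurable_pi_apply (Label.x l)).comp measurable_fst
  have hn : ∀ j, Measurable fun p : (Label M N → ℂ) × (Label M N → ℂ) => (coord M N).n k p.2 j :=
    fun j => (measurable_pi_apply (Label.n k j)).comp measurable_snd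
  have e : (fun p : (Label M N → ℂ) × (Label M N → ℂ) => zeroForcing k p.1 p.2 i) =
      fun p => ∑ j, (∑ l, (gram k p.1)⁻¹ i l * star ((coord M N).H k p.1 j l)) *
        (∑ l, (coord M N).H k p.1 j l * (coord M N).x p.1 l + (coord M N).n k p.2 j) := by
    funext p
    simp only [zeroForcing, Matrix.mulVec, dotProduct, Matrix.mul_apply, Pi.add_apply,
      Matrix.conjTranspose_apply]
  rw [e]
  refine Finset.measurable_fun_sum _ fun j _ => ?_
  refine (Finset.measurable_fun_sum _ fun l _ => (hG l).mul ?_).mul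
    ((Finset.measurable_fun_sum _ fun l _ => (hH j l).mul (hx l)).add (hn j))
  exact continuous_star.measurable.comp (hH j l)

lemma coord_xTilde (k : Fin 2) (ω : Label M N → ℂ) :
    (coord M N).xTilde k ω = zeroForcing k ω ω := rfl

@[fun_prop]
lemma measurable_coord_xHat (k : Fin 2) (i : Fin M) :
    Measurable fun ω => (coord M N).xHat σ B k ω i := by
  have h1 : Measurable fun ω => (coord M N).xTilde k ω i := by
    simp only [coord_xTilde]
    exact Measurable.comp (f := fun ω => (ω, ω)) (measurable_zeroForcing k i)
      (measurable_id.prodMk measurable_id)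
  have h2 : Measurable fun ω => (coord M N).level σ B k ω i := by fun_prop
  have h3 : Measurable fun ω => (coord M N).gArt k ω i := measurable_pi_apply _
  unfold Variables.xHat
  fun_prop

@[fun_prop]
lemma measurable_coord_xHatG (k : Fin 2) (i : Fin M) :
    Measurable fun ω => (coord M N).xHatG σ B k ω i := by
  have h1 : Measurable fun ω => (coord M N).x ω i := measurable_pi_apply _
  have h2 : Measurable fun ω => (coord M N).level σ B k ω i := by fun_prop
  have h3 : Measurable fun ω => (coord M N).gSur k ω i := measurable_pi_apply _
  unfold Variables.xHatG
  fun_prop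

variable {s}

@[fun_prop]
lemma measurable_coord_zHat (hs : ∀ k, Measurable (s k)) (k : Fin 2) (i : Fin M) :
    Measurable fun ω => (coord M N).zHat σ B s k ω i := by
  have h2 : Measurable fun ω => s k ((coord M N).level σ B k ω) i :=
    (measurable_pi_apply i).comp ((hs k).comp (measurable_coord_level σ B k))
  have h3 : Measurable fun ω => (coord M N).gCmp k ω i := measurable_pi_apply _
  unfold Variables.zHat
  fun_prop

@[fun_prop]
lemma measurable_coord_zHatG (hs : ∀ k, Measurable (s k)) (k : Fin 2) (i : Fin M) :
    Measurable fun ω => (coord M N).zHatG σ B s k ω i := by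
  have h2 : Measurable fun ω => s k ((coord M N).level σ B k ω) i :=
    (measurable_pi_apply i).comp ((hs k).comp (measurable_coord_level σ B k))
  have h3 : Measurable fun ω => (coord M N).gCmp k ω i := measurable_pi_apply _
  unfold Variables.zHatG
  fun_prop

end Canonical

/-! ### Entrywise equality in law with the surrogate -/

section Columns

variable {M : ℕ} {N : Fin 2 → ℕ}

-- The determinant of the first `M` rows, available because `M ≤ N k`, is a nonzero polynomial in
-- the entries of the channel. Where it does not vanish, `H` is injective and its Gram matrix
-- positive definite.
open scoped ComplexOrder in
lemma ae_det_gram_ne_zero (hMN : ∀ k, M ≤ N k) {σ : ℝ≥0} (hσ : 0 < σ) (k : Fin 2) :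
    ∀ᵐ ω ∂canonicalLaw M N σ, (gram k ω).det ≠ 0 := by
  have := fun l => nullSingletonClass_labelLaw (M := M) (N := N) hσ l
  let g : Fin M × Fin M → Label M N := fun q => .H k (Fin.castLE (hMN k) q.1) q.2
  have hg : Function.Injective g := by
    rintro ⟨j, i⟩ ⟨j', i'⟩ h
    simpa [g] using h
  have hp : MvPolynomial.rename g (Matrix.mvPolynomialX (Fin M) (Fin M) ℂ).det ≠ 0 := by
    simpa using (MvPolynomial.rename_injective g hg).ne (Matrix.det_mvPolynomialX_ne_zero (Fin M) ℂ)
  filter_upwards [ae_eval_ne_zero (ν := labelLaw σ) hp] with ω hω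
  rw [MvPolynomial.eval_rename, RingHom.map_det] at hω
  let Hs : Matrix (Fin M) (Fin M) ℂ := ((coord M N).H k ω).submatrix (Fin.castLE (hMN k)) id
  have hHs : Hs.det ≠ 0 := by
    convert hω using 2
    ext j i
    simp only [RingHom.mapMatrix_apply, Matrix.map_apply, Matrix.mvPolynomialX_apply,
      MvPolynomial.eval_X]
    rfl
  have hinj : Function.Injective ((coord M N).H k ω).mulVec := by
    have h1 : Function.Injective Hs.mulVec :=
      Matrix.mulVec_injective_iff_isUnit.mpr ((Matrix.isUnit_iff_isUnit_det _).mpr hHs.isUnit)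
    intro u v huv
    refine h1 (funext fun j => ?_)
    exact congrFun huv (Fin.castLE (hMN k) j)
  exact (Matrix.isUnit_iff_isUnit_det _).mp
    (Matrix.PosDef.conjTranspose_mul_self _ hinj).isUnit |>.ne_zero

/-- The zero-forcing matrix `P` satisfies `P * Pᴴ = (Hᴴ * H)⁻¹`; the squared norm of its row `i`
scales the receiver noise power to `a k i`. -/
lemma sum_norm_sq_zeroForcing {n m : ℕ} (H : Matrix (Fin n) (Fin m) ℂ) (hH : (Hᴴ * H).det ≠ 0)
    (i : Fin m) : ∑ j, ‖((Hᴴ * H)⁻¹ * Hᴴ) i j‖ ^ 2 = ((Hᴴ * H)⁻¹ i i).re := by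
  have hu : IsUnit (Hᴴ * H).det := hH.isUnit
  have h : ((Hᴴ * H)⁻¹ * Hᴴ) * ((Hᴴ * H)⁻¹ * Hᴴ)ᴴ = (Hᴴ * H)⁻¹ := by
    rw [Matrix.conjTranspose_mul, Matrix.conjTranspose_conjTranspose,
      Matrix.conjTranspose_nonsing_inv, Matrix.conjTranspose_mul,
      Matrix.conjTranspose_conjTranspose, ← Matrix.mul_assoc, Matrix.mul_assoc (Hᴴ * H)⁻¹,
      Matrix.nonsing_inv_mul _ hu, Matrix.one_mul]
  conv_rhs => rw [← h, Matrix.mul_apply, Complex.re_sum]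
  refine Finset.sum_congr rfl fun j _ => ?_
  rw [Matrix.conjTranspose_apply, ← Complex.normSq_eq_norm_sq, Complex.star_def, Complex.mul_conj,
    Complex.ofReal_re]

lemma zeroForcing_eq {k : Fin 2} {y : Label M N → ℂ} (hy : (gram k y).det ≠ 0) (ω : Label M N → ℂ)
    (i : Fin M) : zeroForcing k y ω i = y (.x i) +
      ∑ j, ((gram k y)⁻¹ * ((coord M N).H k y)ᴴ) i j * ω (.n k j) := by
  rw [zeroForcing, Matrix.mulVec_add, Matrix.mulVec_mulVec, Matrix.mul_assoc]
  change (((gram k y)⁻¹ * gram k y) *ᵥ _ + _) i = _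
  rw [Matrix.nonsing_inv_mul _ hy.isUnit, Matrix.one_mulVec]
  rfl

variable (σ : ℝ≥0) (B : Finset ℝ≥0∞)

lemma iIndepFun_canonicalLaw :
    iIndepFun (fun (l : Label M N) (ω : Label M N → ℂ) => ω l) (canonicalLaw M N σ) :=
  iIndepFun_pi (μ := labelLaw σ) (X := fun _ z => z) fun _ => aemeasurable_id

lemma map_eval_canonicalLaw (l : Label M N) :
    (canonicalLaw M N σ).map (fun ω => ω l) = labelLaw σ l :=
  (measurePreserving_eval (labelLaw σ) l).map_eq

lemma a_ne_top (k : Fin 2) (y : Label M N → ℂ) (i : Fin M) : (coord M N).a σ k y i ≠ ∞ :=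
  ENNReal.ofReal_ne_top

/-- With the channel and the input frozen, the variances add up: `a` from zero forcing and `v - a`
from the artificial noise make `v`, the variance of the surrogate. If `v = ∞`, then `v - a = ∞` as
`a` is finite, and both sides are erased. -/
lemma map_addNoise_zeroForcing {k : Fin 2} {y : Label M N → ℂ} (hy : (gram k y).det ≠ 0)
    (i : Fin M) :
    (canonicalLaw M N σ).map (fun ω => addNoise ((coord M N).level σ B k y i -
      (coord M N).a σ k y i) (zeroForcing k y ω i) (ω (.gArt k i))) =
    (canonicalLaw M N σ).map (fun ω => addNoise ((coord M N).level σ B k y i) (y (.x i))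
      (ω (.gSur k i))) := by
  set v := (coord M N).level σ B k y i with hv
  set a := (coord M N).a σ k y i with ha
  have hav : a ≤ v := le_gridCeil B _
  have hatop : a ≠ ∞ := a_ne_top σ k y i
  by_cases hvt : v = ∞
  · simp [addNoise, hvt, hatop]
  have hsub : v - a ≠ ∞ := ne_top_of_le_ne_top hvt tsub_le_self
  simp only [addNoise, hvt, hsub, if_false, zeroForcing_eq hy]
  let P := (gram k y)⁻¹ * ((coord M N).H k y)ᴴ
  have hPa : ∑ j, ‖P i j‖ ^ 2 * (σ : ℝ) ^ 2 = a.toReal := by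
    rw [← Finset.sum_mul]
    have h1 := sum_norm_sq_zeroForcing ((coord M N).H k y) hy i
    change ∑ j, ‖P i j‖ ^ 2 = ((gram k y)⁻¹ i i).re at h1
    have h2 : a.toReal = (((σ : ℂ) ^ 2 * (gram k y)⁻¹ i i).re) := by
      refine ENNReal.toReal_ofReal ?_
      change 0 ≤ ((σ : ℂ) ^ 2 * (gram k y)⁻¹ i i).re
      rw [← Complex.ofReal_pow, Complex.re_ofReal_mul, ← h1]
      positivity
    rw [h2, ← Complex.ofReal_pow, Complex.re_ofReal_mul, ← h1, mul_comm]
  -- The total noise is one linear combination of independent Gaussians: `none` stands for the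
  -- artificial noise, `some j` for the receiver noise at antenna `j`.
  let lab : Option (Fin (N k)) → Label M N := fun o => o.elim (.gArt k i) (.n k)
  have hlab : Function.Injective lab := by
    rintro (_ | j) (_ | j') h <;> simp_all [lab]
  let c : Option (Fin (N k)) → ℂ := fun o => o.elim (Real.sqrt (v - a).toReal : ℂ) (P i)
  let w : Option (Fin (N k)) → ℝ≥0 := fun o => o.elim 1 fun _ => σ ^ 2
  have h1 := map_sum_complexGaussian (X := fun o (ω : Label M N → ℂ) => ω (lab o))
    (μ := canonicalLaw M N σ) (fun o => measurable_pi_apply _)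
    ((iIndepFun_canonicalLaw σ).precomp hlab) (v := w)
    (fun o => by cases o <;> exact map_eval_canonicalLaw σ _) c
  have h2 := map_sum_complexGaussian (X := fun (_ : Unit) (ω : Label M N → ℂ) => ω (.gSur k i))
    (μ := canonicalLaw M N σ) (fun o => measurable_pi_apply _)
    ((iIndepFun_canonicalLaw σ).precomp (g := fun _ : Unit => .gSur k i)
      (Function.injective_of_subsingleton _)) (v := fun _ => 1)
    (fun o => map_eval_canonicalLaw σ _) (fun _ => (Real.sqrt v.toReal : ℂ))
  have hw : ∑ o, ‖c o‖₊ ^ 2 * w o = ∑ _ : Unit, ‖(Real.sqrt v.toReal : ℂ)‖₊ ^ 2 * 1 := by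
    rw [← NNReal.coe_inj]
    simp only [Fintype.sum_option, c, w, Option.elim, Finset.univ_unique, Finset.sum_const,
      Finset.card_singleton, one_smul, mul_one, NNReal.coe_add, NNReal.coe_sum, NNReal.coe_mul,
      NNReal.coe_pow, coe_nnnorm, Complex.norm_real, Real.norm_eq_abs, sq_abs]
    rw [Real.sq_sqrt ENNReal.toReal_nonneg, Real.sq_sqrt ENNReal.toReal_nonneg, hPa,
      ENNReal.toReal_sub_of_le hav hvt]
    ring
  rw [hw, ← h2] at h1
  have h3 := congrArg (Measure.map fun z => y (.x i) + z) h1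
  rw [Measure.map_map (by fun_prop) (by fun_prop), Measure.map_map (by fun_prop) (by fun_prop)]
    at h3
  convert h3 using 2
  · funext ω
    simp only [Function.comp_apply, Fintype.sum_option, c, lab, Option.elim, P]
    ring
  · funext ω
    simp

/-- The coordinates of the input, the channels and the compression noises. -/
def base (ω : Label M N → ℂ) : Label M N → ℂ
  | .x i => ω (.x i)
  | .H k j i => ω (.H k j i)
  | .gCmp k i => ω (.gCmp k i)
  | _ => 0

@[fun_prop]
lemma measurable_base : Measurable (base : (Label M N → ℂ) → _) := by
  refine measurable_pi_lambda _ fun l => ?_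
  cases l <;> simp only [base] <;> fun_prop

/-- Jointly with the input, the channels and the compression noises, a column of `xHat` has the same
law as its surrogate. -/
lemma map_base_xHat_eq (hMN : ∀ k, M ≤ N k) (hσ : 0 < σ) (i : Fin M) :
    (canonicalLaw M N σ).map (fun ω => (base ω, fun k => (coord M N).xHat σ B k ω i)) =
      (canonicalLaw M N σ).map (fun ω => (base ω, fun k => (coord M N).xHatG σ B k ω i)) := by
  -- One block of noises for each relay; the input, the channels and the compression noises form the
  -- common block.
  let b : Label M N → Option (Fin 2) := fun l => match l with
    | .n k _ => some k
    | .gArt k _ => some k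
    | .gSur k _ => some k
    | _ => none
  let φ : Fin 2 → (Label M N → ℂ) × (Label M N → ℂ) → ℂ := fun k p =>
    addNoise ((coord M N).level σ B k p.1 i - (coord M N).a σ k p.1 i) (zeroForcing k p.1 p.2 i)
      (p.2 (.gArt k i))
  let ψ : Fin 2 → (Label M N → ℂ) × (Label M N → ℂ) → ℂ := fun k p =>
    addNoise ((coord M N).level σ B k p.1 i) (p.1 (.x i)) (p.2 (.gSur k i))
  have hlev : ∀ k, Measurable fun p : (Label M N → ℂ) × (Label M N → ℂ) =>
      (coord M N).level σ B k p.1 i := fun k =>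
    (measurable_pi_apply i).comp ((measurable_coord_level σ B k).comp measurable_fst)
  have hφ : ∀ k, Measurable (φ k) := fun k => by
    have := measurable_zeroForcing (N := N) k i
    have := hlev k
    have : Measurable fun p : (Label M N → ℂ) × (Label M N → ℂ) => (coord M N).a σ k p.1 i :=
      (measurable_coord_a σ k i).comp measurable_fst
    fun_prop
  have hψ : ∀ k, Measurable (ψ k) := fun k => by
    have := hlev k
    fun_prop
  have := fun k => isMarkovKernel_paramKernel (hφ k) (canonicalLaw M N σ)
  have := fun k => isMarkovKernel_paramKernel (hψ k) (canonicalLaw M N σ)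
  have hb : ∀ ω ω' : Label M N → ℂ, (∀ l, b l = none → ω l = ω' l) → base ω = base ω' := by
    intro ω ω' h
    funext l
    cases l <;> simp only [base] <;> exact h _ rfl
  have h1 := map_blocks_eq_compProd (labelLaw σ) b measurable_base hb hφ (by
    intro k y ω ω' h
    have hn : (coord M N).n k ω = (coord M N).n k ω' := funext fun j => h (.n k j) rfl
    simp only [φ, zeroForcing, hn, h (.gArt k i) rfl])
  have h2 := map_blocks_eq_compProd (labelLaw σ) b measurable_base hb hψ (by
    intro k y ω ω' h
    simp only [ψ, h (.gSur k i) rfl])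
  refine h1.trans (Eq.trans ?_ h2.symm)
  refine Measure.compProd_congr ?_
  -- `base` keeps the channel coordinates, so the Gram matrices of `base ω` and `ω` coincide.
  have hgood : ∀ᵐ y ∂(canonicalLaw M N σ).map base, ∀ k, (gram k y).det ≠ 0 := by
    rw [ae_map_iff measurable_base.aemeasurable]
    · rw [ae_all_iff]
      exact fun k => ae_det_gram_ne_zero hMN hσ k
    · have hopen : ∀ k, MeasurableSet {y : Label M N → ℂ | (gram k y).det ≠ 0} := fun k =>
        (isOpen_ne_fun (continuous_gram k).matrix_det continuous_const).measurableSet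
      simpa only [Set.ofPred_forall] using MeasurableSet.iInter hopen
  filter_upwards [hgood] with y hy
  rw [kernelPi_apply, kernelPi_apply]
  congr 1
  funext k
  rw [paramKernel_apply (hφ k), paramKernel_apply (hψ k)]
  exact map_addNoise_zeroForcing σ B (hy k) i

end Columns

end QCI

namespace QCI

/-! ### The comparison principles applied to the relays -/

section Scheme

variable {M : ℕ} {N : Fin 2 → ℕ} (σ : ℝ≥0) (B : Finset ℝ≥0∞)
  {s : Fin 2 → (Fin M → ℝ≥0∞) → Fin M → ℝ≥0∞}

lemma coord_level_congr {k : Fin 2} {ω ω' : Label M N → ℂ}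
    (h : ∀ j i, ω (.H k j i) = ω' (.H k j i)) :
    (coord M N).level σ B k ω = (coord M N).level σ B k ω' := by
  have hH : (coord M N).H k ω = (coord M N).H k ω' := funext fun j => funext fun i => h j i
  funext i
  simp only [Variables.level, Variables.a, Variables.A, hH]

lemma coord_levels_congr {ω ω' : Label M N → ℂ} (h : ∀ k j i, ω (.H k j i) = ω' (.H k j i)) :
    (coord M N).levels σ B ω = (coord M N).levels σ B ω' :=
  funext fun k => coord_level_congr σ B (h k)

lemma coord_xHat_congr {ω ω' : Label M N → ℂ}
    (h : ∀ l : Label M N, (∀ k i, l ≠ .gCmp k i) → ω l = ω' l) (k : Fin 2) :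
    (coord M N).xHat σ B k ω = (coord M N).xHat σ B k ω' := by
  have hH : (coord M N).H k ω = (coord M N).H k ω' :=
    funext fun j => funext fun i => h (.H k j i) (by simp)
  have hx : (coord M N).x ω = (coord M N).x ω' := funext fun i => h (.x i) (by simp)
  have hn : (coord M N).n k ω = (coord M N).n k ω' := funext fun i => h (.n k i) (by simp)
  have hg : (coord M N).gArt k ω = (coord M N).gArt k ω' := funext fun i => h (.gArt k i) (by simp)
  funext i
  simp only [Variables.xHat, Variables.level, Variables.a, Variables.A, Variables.xTilde,
    Variables.y, hH, hx, hn, hg]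

lemma coord_xHatG_congr {ω ω' : Label M N → ℂ}
    (h : ∀ l : Label M N, (∀ k i, l ≠ .gCmp k i) → ω l = ω' l) (k : Fin 2) :
    (coord M N).xHatG σ B k ω = (coord M N).xHatG σ B k ω' := by
  have hx : (coord M N).x ω = (coord M N).x ω' := funext fun i => h (.x i) (by simp)
  have hg : (coord M N).gSur k ω = (coord M N).gSur k ω' := funext fun i => h (.gSur k i) (by simp)
  funext i
  simp only [Variables.xHatG, hx, hg, coord_level_congr σ B fun j i => h (.H k j i) (by simp)]

@[fun_prop]
lemma measurable_compression (hs : ∀ k, Measurable (s k)) {α : Type*} [MeasurableSpace α]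
    {l : α → Fin 2 → Fin M → ℝ≥0∞} (hl : Measurable l) {u g : α → ℂ} (hu : Measurable u)
    (hg : Measurable g) (k : Fin 2) (i : Fin M) :
    Measurable fun a => addNoise (s k (l a k) i) (u a) (g a) := by
  have : Measurable fun a => s k (l a k) i :=
    (measurable_pi_apply i).comp ((hs k).comp ((measurable_pi_apply k).comp hl))
  fun_prop

/-- Functions of the columns of the input, the surrogate noises and the compression noises are
conditionally independent given the levels. -/
lemma map_columns_eq_compProd {γ : Type*} [MeasurableSpace γ]
    {φ : Fin M → (Fin 2 → Fin M → ℝ≥0∞) × (Label M N → ℂ) → γ} (hφ : ∀ i, Measurable (φ i))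
    (hφc : ∀ i l ω ω', ω (.x i) = ω' (.x i) → (∀ k, ω (.gSur k i) = ω' (.gSur k i)) →
      (∀ k, ω (.gCmp k i) = ω' (.gCmp k i)) → φ i (l, ω) = φ i (l, ω'))
    [∀ i, IsMarkovKernel (paramKernel (φ i) (canonicalLaw M N σ))] :
    (canonicalLaw M N σ).map (fun ω => ((coord M N).levels σ B ω,
        fun i => φ i ((coord M N).levels σ B ω, ω))) =
      (canonicalLaw M N σ).map ((coord M N).levels σ B) ⊗ₘ
        kernelPi fun i => paramKernel (φ i) (canonicalLaw M N σ) := by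
  let b : Label M N → Option (Fin M) := fun l => match l with
    | .x i => some i
    | .gSur _ i => some i
    | .gCmp _ i => some i
    | _ => none
  exact map_blocks_eq_compProd (labelLaw σ) b (measurable_coord_levels σ B)
    (fun ω ω' h => coord_levels_congr σ B fun k j i => h (.H k j i) rfl) hφ
    fun i l ω ω' h => hφc i l ω ω' (h _ rfl) (fun k => h _ rfl) fun k => h _ rfl

section Compression

variable (T : Finset (Fin 2))

/-- The entry `i` of the representations given the levels and the entry of the estimates. -/
noncomputable def compress (s : Fin 2 → (Fin M → ℝ≥0∞) → Fin M → ℝ≥0∞) (i : Fin M)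
    (q : (((({k // k ∈ Tᶜ} → ℂ) × (Fin 2 → Fin M → ℝ≥0∞)) × ({k // k ∈ T} → ℂ)) ×
      (Label M N → ℂ))) : {k // k ∈ T} → ℂ :=
  fun k => addNoise (s k (q.1.1.2 k) i) (q.1.2 k) (q.2 (.gCmp k i))

lemma measurable_compress (hs : ∀ k, Measurable (s k)) (i : Fin M) :
    Measurable (compress T s i : _ × (Label M N → ℂ) → _) := by
  refine measurable_pi_lambda _ fun k => ?_
  exact measurable_compression hs (by fun_prop) (by fun_prop) (by fun_prop) _ _

/-- The entry `i` of the conditioning variables. -/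
def condEntry (i : Fin M) (c : ({k // k ∈ Tᶜ} → Fin M → ℂ) × (Fin 2 → Fin M → ℝ≥0∞)) :
    ({k // k ∈ Tᶜ} → ℂ) × (Fin 2 → Fin M → ℝ≥0∞) :=
  (fun k => c.1 k i, c.2)

lemma measurable_condEntry (i : Fin M) : Measurable (condEntry T i) := by
  unfold condEntry
  fun_prop

/-- The entry `i` of a family of vectors. -/
def entryOf {S : Finset (Fin 2)} (i : Fin M) (x : {k // k ∈ S} → Fin M → ℂ) : {k // k ∈ S} → ℂ :=
  fun k => x k i

lemma measurable_entryOf {S : Finset (Fin 2)} (i : Fin M) :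
    Measurable (entryOf i : ({k // k ∈ S} → Fin M → ℂ) → _) := by
  unfold entryOf
  fun_prop

/-- The compression noises of the relays in `T` are independent of the estimates, the levels and the
other relays' representations, so compression in `T` is a memoryless channel. This is proved for any
`X` free of compression noise, to serve both the scheme and its surrogate. -/
lemma map_compress_eq_compProd (hs : ∀ k, Measurable (s k))
    {X : Fin 2 → (Label M N → ℂ) → Fin M → ℂ} (hX : ∀ k i, Measurable fun ω => X k ω i)
    (hXc : ∀ ω ω' : Label M N → ℂ, (∀ l : Label M N, (∀ k i, l ≠ .gCmp k i) → ω l = ω' l) →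
      ∀ k, X k ω = X k ω')
    {W : Fin 2 → (Label M N → ℂ) → Fin M → ℂ}
    (hW : ∀ k ω i, W k ω i = addNoise (s k ((coord M N).level σ B k ω) i) (X k ω i)
      (ω (.gCmp k i)))
    [∀ i, IsMarkovKernel (paramKernel (compress T s i) (canonicalLaw M N σ))] :
    (canonicalLaw M N σ).map (fun ω => (((restrict Tᶜ W ω, (coord M N).levels σ B ω),
        restrict T X ω), fun i => entryOf i (restrict T W ω))) =
      ((canonicalLaw M N σ).map fun ω => ((restrict Tᶜ W ω, (coord M N).levels σ B ω),
        restrict T X ω)) ⊗ₘ kernelPi fun i =>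
          (paramKernel (compress T s i) (canonicalLaw M N σ)).comap
            (Prod.map (condEntry T i) (entryOf i))
            ((measurable_condEntry T i).prodMap (measurable_entryOf i)) := by
  -- Compression noises outside `T` stay in the common block, since they enter the conditioning
  -- variable.
  let b : Label M N → Option (Fin M) := fun l => match l with
    | .gCmp k i => if k ∈ T then some i else none
    | _ => none
  have hWm : ∀ k i, Measurable fun ω => W k ω i := fun k i => by
    simp only [hW]
    exact measurable_compression hs (measurable_coord_levels σ B) (hX k i) (by fun_prop) k i
  have hF : Measurable fun ω => ((restrict Tᶜ W ω, (coord M N).levels σ B ω), restrict T X ω) := by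
    unfold restrict
    fun_prop
  let φ : Fin M → (((({k // k ∈ Tᶜ} → Fin M → ℂ) × (Fin 2 → Fin M → ℝ≥0∞)) ×
      ({k // k ∈ T} → Fin M → ℂ)) × (Label M N → ℂ)) → {k // k ∈ T} → ℂ := fun i =>
    compress T s i ∘ Prod.map (Prod.map (condEntry T i) (entryOf i)) id
  have hφ : ∀ i, Measurable (φ i) := fun i => (measurable_compress T hs i).comp
    (((measurable_condEntry T i).prodMap (measurable_entryOf i)).prodMap measurable_id)
  have := fun i => isMarkovKernel_paramKernel (hφ i) (canonicalLaw M N σ)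
  have h := map_blocks_eq_compProd (labelLaw σ) b hF (by
      intro ω ω' h
      have hb : ∀ l : Label M N, (∀ k i, l ≠ .gCmp k i) → b l = none := by
        intro l hl
        cases l with
        | gCmp k i => exact absurd rfl (hl k i)
        | _ => rfl
      have hXX := hXc ω ω' fun l hl => h l (hb l hl)
      have hL := coord_levels_congr σ B fun k j i => h (.H k j i) rfl
      refine Prod.ext (Prod.ext (funext fun k => funext fun i => ?_) hL) (funext fun k => hXX k)
      simp only [restrict, hW]
      rw [hXX, coord_level_congr σ B fun j i => h (.H k j i) rfl, h (.gCmp k i)]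
      simp [b, Finset.mem_compl.mp k.2]) hφ (by
      intro i y ω ω' h
      funext k
      simp only [φ, compress, Function.comp_apply, Prod.map_snd, id]
      rw [h (.gCmp k i)]
      · rfl
      · simp [b])
  refine Eq.trans ?_ (h.trans ?_)
  · congr 1
    funext ω
    refine Prod.ext rfl (funext fun i => funext fun k => ?_)
    exact hW k ω i
  · congr 2
    funext i
    ext a : 1
    rw [Kernel.comap_apply, paramKernel_apply (hφ i), paramKernel_apply (measurable_compress T hs i)]
    rfl

/-- The entry `i` of the surrogate representations given the levels. -/
noncomputable def surrogateEntry (s : Fin 2 → (Fin M → ℝ≥0∞) → Fin M → ℝ≥0∞) (i : Fin M)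
    (q : (Fin 2 → Fin M → ℝ≥0∞) × (Label M N → ℂ)) (k : Fin 2) : ℂ :=
  addNoise (s k (q.1 k) i) (addNoise (q.1 k i) (q.2 (.x i)) (q.2 (.gSur k i))) (q.2 (.gCmp k i))

lemma measurable_surrogateEntry (hs : ∀ k, Measurable (s k)) (i : Fin M) (k : Fin 2) :
    Measurable fun q : (Fin 2 → Fin M → ℝ≥0∞) × (Label M N → ℂ) => surrogateEntry s i q k :=
  measurable_compression hs (by fun_prop) (by fun_prop) (by fun_prop) _ _

lemma surrogateEntry_congr (i : Fin M) (l : Fin 2 → Fin M → ℝ≥0∞) (ω ω' : Label M N → ℂ)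
    (hx : ω (.x i) = ω' (.x i)) (hg : ∀ k, ω (.gSur k i) = ω' (.gSur k i))
    (hc : ∀ k, ω (.gCmp k i) = ω' (.gCmp k i)) :
    surrogateEntry s i (l, ω) = surrogateEntry s i (l, ω') := by
  funext k
  simp only [surrogateEntry, hx, hg k, hc k]

/-- The comparison of the compression rates. -/
lemma condMutualInfo_xHat_le (hMN : ∀ k, M ≤ N k) (hσ : 0 < σ) (hs : ∀ k, Measurable (s k)) :
    condMutualInfo (restrict T ((coord M N).xHat σ B)) (restrict T ((coord M N).zHat σ B s))
        (fun ω => (restrict Tᶜ ((coord M N).zHat σ B s) ω, (coord M N).levels σ B ω))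
        (canonicalLaw M N σ) ≤
      condMutualInfo (restrict T ((coord M N).xHatG σ B)) (restrict T ((coord M N).zHatG σ B s))
        (fun ω => (restrict Tᶜ ((coord M N).zHatG σ B s) ω, (coord M N).levels σ B ω))
        (canonicalLaw M N σ) := by
  have hx : ∀ S : Finset (Fin 2), Measurable (restrict S ((coord M N).xHat σ B)) := fun S => by
    unfold restrict; fun_prop
  have hxG : ∀ S : Finset (Fin 2), Measurable (restrict S ((coord M N).xHatG σ B)) := fun S => by
    unfold restrict; fun_prop
  have hz : ∀ S : Finset (Fin 2), Measurable (restrict S ((coord M N).zHat σ B s)) := fun S =>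
    measurable_pi_lambda _ fun k => measurable_pi_lambda _ fun i =>
      measurable_coord_zHat σ B hs k i
  have hzG : ∀ S : Finset (Fin 2), Measurable (restrict S ((coord M N).zHatG σ B s)) := fun S =>
    measurable_pi_lambda _ fun k => measurable_pi_lambda _ fun i =>
      measurable_coord_zHatG σ B hs k i
  have hC := (hz Tᶜ).prodMk (measurable_coord_levels σ B)
  have hCG := (hzG Tᶜ).prodMk (measurable_coord_levels σ B)
  have ht : Measurable fun (z : {k // k ∈ T} → Fin M → ℂ) (i : Fin M) => entryOf i z :=
    measurable_pi_lambda _ fun i => measurable_entryOf i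
  have ht' : Measurable fun (z : Fin M → {k // k ∈ T} → ℂ) (k : {k // k ∈ T}) (i : Fin M) =>
    z i k := by fun_prop
  -- The comparison needs the representations indexed by entry first and by relay second; such a
  -- reshaping is invertible and preserves the information.
  rw [← condMutualInfo_comp_right (hx T) (hz T) hC ht ht' fun _ => rfl,
    ← condMutualInfo_comp_right (hxG T) (hzG T) hCG ht ht' fun _ => rfl]
  have := fun i => isMarkovKernel_paramKernel (measurable_compress (N := N) T hs i)
    (canonicalLaw M N σ)
  let φ : Fin M → (Fin 2 → Fin M → ℝ≥0∞) × (Label M N → ℂ) →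
      ({k // k ∈ Tᶜ} → ℂ) × ({k // k ∈ T} → ℂ) := fun i q =>
    (fun k => surrogateEntry s i q k, fun k => surrogateEntry s i q k)
  have hφ : ∀ i, Measurable (φ i) := fun i =>
    Measurable.prodMk (measurable_pi_lambda _ fun k => measurable_surrogateEntry hs i k)
      (measurable_pi_lambda _ fun k => measurable_surrogateEntry hs i k)
  have := fun i => isMarkovKernel_paramKernel (hφ i) (canonicalLaw M N σ)
  have hcol := map_columns_eq_compProd σ B hφ fun i l ω ω' h1 h2 h3 => by
    simp only [φ, surrogateEntry_congr i l ω ω' h1 h2 h3]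
  have hpair := map_pair_eq_compProd_condKernel (measurable_coord_levels σ B)
    (A := fun ω i => entryOf i (restrict Tᶜ ((coord M N).zHatG σ B s) ω))
    (measurable_pi_lambda _ fun i => (measurable_entryOf i).comp (hzG Tᶜ))
    (B := fun ω i => entryOf i (restrict T ((coord M N).zHatG σ B s) ω))
    (measurable_pi_lambda _ fun i => (measurable_entryOf i).comp (hzG T)) _ hcol
  -- In the surrogate, entry `i` of the relays in `T` depends on the other relays only through their
  -- entry `i`, given the levels; `Q i` is this conditional law.
  let Q : Fin M → Kernel (({k // k ∈ Tᶜ} → ℂ) × (Fin 2 → Fin M → ℝ≥0∞)) ({k // k ∈ T} → ℂ) :=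
    fun i => (paramKernel (φ i) (canonicalLaw M N σ)).condKernel.comap Prod.swap measurable_swap
  have : ∀ i, IsMarkovKernel (Q i) := fun i => inferInstanceAs (IsMarkovKernel (Kernel.comap _ _ _))
  refine condMutualInfo_le_of_memoryless hC hCG (hx T) (hxG T) (ht.comp (hz T)) (ht.comp (hzG T))
    (measurable_condEntry T) (p := fun i => entryOf i) measurable_entryOf
    (fun i => paramKernel (compress T s i) (canonicalLaw M N σ)) Q ?_ ?_ ?_ ?_
  · exact map_compress_eq_compProd σ B T hs (measurable_coord_xHat σ B)
      (fun ω ω' h k => coord_xHat_congr σ B h k) fun _ _ _ => rfl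
  · exact map_compress_eq_compProd σ B T hs (measurable_coord_xHatG σ B)
      (fun ω ω' h k => coord_xHatG_congr σ B h k) fun _ _ _ => rfl
  · let e : (Fin 2 → Fin M → ℝ≥0∞) × (Fin M → {k // k ∈ Tᶜ} → ℂ) →
        ({k // k ∈ Tᶜ} → Fin M → ℂ) × (Fin 2 → Fin M → ℝ≥0∞) := fun q =>
      (fun k i => q.2 i k, q.1)
    have he : Measurable e := by fun_prop
    have hLA : Measurable fun ω => ((coord M N).levels σ B ω,
        fun i => entryOf i (restrict Tᶜ ((coord M N).zHatG σ B s) ω)) :=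
      (measurable_coord_levels σ B).prodMk
        (measurable_pi_lambda _ fun i => (measurable_entryOf i).comp (hzG Tᶜ))
    have : IsProbabilityMeasure ((canonicalLaw M N σ).map fun ω => ((coord M N).levels σ B ω,
        fun i => entryOf i (restrict Tᶜ ((coord M N).zHatG σ B s) ω))) :=
      Measure.isProbabilityMeasure_map hLA.aemeasurable
    have h := congrArg (Measure.map fun p => (e p.1, p.2)) hpair
    have hB : Measurable fun ω (i : Fin M) =>
        entryOf i (restrict T ((coord M N).zHatG σ B s) ω) := ht.comp (hzG T)
    rw [Measure.map_map (by fun_prop) (hLA.prodMk hB)] at h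
    refine Eq.trans h ?_
    have h2 := map_compProd_comap he ((canonicalLaw M N σ).map fun ω => ((coord M N).levels σ B ω,
        fun i => entryOf i (restrict Tᶜ ((coord M N).zHatG σ B s) ω)))
      (kernelPi fun i => (Q i).comap (condEntry T i) (measurable_condEntry T i))
    rw [Measure.map_map he hLA] at h2
    exact h2
  · intro i
    -- Entry `i` of the representations and the levels are computed from `base` and column `i` of
    -- the estimates by a map common to both schemes, so the equality of column laws carries over.
    let g : (Label M N → ℂ) × (Fin 2 → ℂ) →
        (({k // k ∈ Tᶜ} → ℂ) × (Fin 2 → Fin M → ℝ≥0∞)) × ({k // k ∈ T} → ℂ) := fun q =>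
      ((fun k => addNoise (s k ((coord M N).levels σ B q.1 k) i) (q.2 k) (q.1 (.gCmp k i)),
        (coord M N).levels σ B q.1), fun k => q.2 k)
    have hg : Measurable g := by
      have hl : Measurable fun q : (Label M N → ℂ) × (Fin 2 → ℂ) => (coord M N).levels σ B q.1 :=
        (measurable_coord_levels σ B).comp measurable_fst
      refine Measurable.prodMk (Measurable.prodMk ?_ hl) (by fun_prop)
      exact measurable_pi_lambda _ fun k =>
        measurable_compression hs hl (by fun_prop) (by fun_prop) _ _
    have h := congrArg (Measure.map g) (map_base_xHat_eq σ B hMN hσ i)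
    rw [Measure.map_map hg (by fun_prop), Measure.map_map hg (by fun_prop)] at h
    exact h

/-- The comparison of the informations about the input. -/
lemma condMutualInfo_x_le (hMN : ∀ k, M ≤ N k) (hσ : 0 < σ) (hs : ∀ k, Measurable (s k)) :
    condMutualInfo (coord M N).x (fun ω k => (coord M N).zHatG σ B s k ω)
        ((coord M N).levels σ B) (canonicalLaw M N σ) ≤
      condMutualInfo (coord M N).x (fun ω k => (coord M N).zHat σ B s k ω)
        ((coord M N).levels σ B) (canonicalLaw M N σ) := by
  have hx : Measurable (coord M N).x := measurable_pi_lambda _ fun i => measurable_pi_apply _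
  have hz : Measurable fun ω k => (coord M N).zHat σ B s k ω :=
    measurable_pi_lambda _ fun k => measurable_pi_lambda _ fun i =>
      measurable_coord_zHat σ B hs k i
  have hzG : Measurable fun ω k => (coord M N).zHatG σ B s k ω :=
    measurable_pi_lambda _ fun k => measurable_pi_lambda _ fun i =>
      measurable_coord_zHatG σ B hs k i
  let ξ : Fin M → (Fin 2 → Fin M → ℝ≥0∞) × (Label M N → ℂ) → ℂ := fun i q => q.2 (.x i)
  have hξ : ∀ i, Measurable (ξ i) := fun i => by fun_prop
  have := fun i => isMarkovKernel_paramKernel (hξ i) (canonicalLaw M N σ)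
  have hprior := map_columns_eq_compProd σ B hξ fun i l ω ω' h1 _ _ => h1
  let φ : Fin M → (Fin 2 → Fin M → ℝ≥0∞) × (Label M N → ℂ) → (Fin 2 → ℂ) × ℂ := fun i q =>
    (surrogateEntry s i q, q.2 (.x i))
  have hφ : ∀ i, Measurable (φ i) := fun i =>
    (measurable_pi_lambda _ fun k => measurable_surrogateEntry hs i k).prodMk (by fun_prop)
  have := fun i => isMarkovKernel_paramKernel (hφ i) (canonicalLaw M N σ)
  have hcol := map_columns_eq_compProd σ B hφ fun i l ω ω' h1 h2 h3 => by
    simp only [φ, surrogateEntry_congr i l ω ω' h1 h2 h3, h1]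
  have hA : Measurable fun ω (i : Fin M) k => (coord M N).zHatG σ B s k ω i :=
    measurable_pi_lambda _ fun i => measurable_pi_lambda _ fun k =>
      measurable_coord_zHatG σ B hs k i
  -- The pairs of a surrogate column and its input entry are independent across columns given the
  -- levels, so the posterior of the input factorizes.
  have hpair := map_pair_eq_compProd_condKernel (measurable_coord_levels σ B)
    (A := fun ω i k => (coord M N).zHatG σ B s k ω i) hA (B := (coord M N).x) hx _ hcol
  refine condMutualInfo_le_of_independent (measurable_coord_levels σ B) hx hz hzG
    (r := fun i z k => z k i) (fun i => by fun_prop)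
    (fun i => paramKernel (ξ i) (canonicalLaw M N σ))
    (fun i => (paramKernel (φ i) (canonicalLaw M N σ)).condKernel) hprior ?_ ?_
  · let e : (Fin 2 → Fin M → ℝ≥0∞) × (Fin M → Fin 2 → ℂ) →
        (Fin 2 → Fin M → ℝ≥0∞) × (Fin 2 → Fin M → ℂ) := fun q => (q.1, fun k i => q.2 i k)
    have he : Measurable e := by fun_prop
    have hLA := (measurable_coord_levels σ B).prodMk hA
    have : IsProbabilityMeasure ((canonicalLaw M N σ).map fun ω => ((coord M N).levels σ B ω,
        fun (i : Fin M) k => (coord M N).zHatG σ B s k ω i)) :=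
      Measure.isProbabilityMeasure_map hLA.aemeasurable
    have h := congrArg (Measure.map fun p => (e p.1, p.2)) hpair
    rw [Measure.map_map (by fun_prop) (hLA.prodMk hx)] at h
    refine Eq.trans h ?_
    have h2 := map_compProd_comap he ((canonicalLaw M N σ).map fun ω => ((coord M N).levels σ B ω,
        fun (i : Fin M) k => (coord M N).zHatG σ B s k ω i))
      (kernelPi fun i => (paramKernel (φ i) (canonicalLaw M N σ)).condKernel.comap
        (Prod.map id fun (z : Fin 2 → Fin M → ℂ) k => z k i)
        (measurable_id.prodMap (by fun_prop)))
    rw [Measure.map_map he hLA] at h2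
    exact h2
  · intro i
    let g : (Label M N → ℂ) × (Fin 2 → ℂ) →
        ((Fin 2 → Fin M → ℝ≥0∞) × (Fin 2 → ℂ)) × ℂ := fun q =>
      (((coord M N).levels σ B q.1, fun k => addNoise (s k ((coord M N).levels σ B q.1 k) i) (q.2 k)
        (q.1 (.gCmp k i))), q.1 (.x i))
    have hg : Measurable g := by
      have hl : Measurable fun q : (Label M N → ℂ) × (Fin 2 → ℂ) => (coord M N).levels σ B q.1 :=
        (measurable_coord_levels σ B).comp measurable_fst
      refine Measurable.prodMk (Measurable.prodMk hl ?_) (by fun_prop)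
      exact measurable_pi_lambda _ fun k =>
        measurable_compression hs hl (by fun_prop) (by fun_prop) _ _
    have h := congrArg (Measure.map g) (map_base_xHat_eq σ B hMN hσ i)
    rw [Measure.map_map hg (by fun_prop), Measure.map_map hg (by fun_prop)] at h
    exact h

end Compression

end Scheme

end QCI

/-! ### Transfer to an arbitrary probability space -/

theorem lemma1 {Ω : Type*} [MeasurableSpace Ω] (μ : MeasureTheory.Measure Ω)
    [MeasureTheory.IsProbabilityMeasure μ]
    (M : ℕ) (N : Fin 2 → ℕ) (hMN : ∀ k, M ≤ N k)
    (σ : ℝ≥0) (hσ : 0 < σ)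
    (B : Finset ℝ≥0∞) (hBpos : ∀ b ∈ B, 0 < b) (hBtop : ∞ ∈ B)
    (s : Fin 2 → (Fin M → ℝ≥0∞) → Fin M → ℝ≥0∞)
    (V : QCI.Variables Ω M N) (hV : V.IsGaussian σ μ) :
    (∀ T : Finset (Fin 2),
      QCI.condMutualInfo (QCI.restrict T (V.xHat σ B)) (QCI.restrict T (V.zHat σ B s))
          (fun ω => (QCI.restrict Tᶜ (V.zHat σ B s) ω, V.levels σ B ω)) μ
        ≤ QCI.condMutualInfo (QCI.restrict T (V.xHatG σ B)) (QCI.restrict T (V.zHatG σ B s))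
          (fun ω => (QCI.restrict Tᶜ (V.zHatG σ B s) ω, V.levels σ B ω)) μ) ∧
    QCI.condMutualInfo V.x (fun ω k => V.zHatG σ B s k ω) (V.levels σ B) μ
      ≤ QCI.condMutualInfo V.x (fun ω k => V.zHat σ B s k ω) (V.levels σ B) μ := by
  open QCI in
  have hfin : {l : Fin M → ℝ≥0∞ | ∀ i, l i ∈ B}.Finite := by
    have := Set.Finite.pi (t := fun _ : Fin M => (B : Set ℝ≥0∞)) fun _ => B.finite_toSet
    simpa [Set.pi] using this
  -- All levels lie in the grid, since `∞ ∈ B` makes every ceiling a minimum over a nonempty set; so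
  -- `s` may be replaced by a measurable `s'`.
  choose s' hs' hss' using fun k => exists_measurable_eqOn_finite hfin (s k)
  have hsl : ∀ k ω, s k (V.level σ B k ω) = s' k (V.level σ B k ω) := fun k ω =>
    (hss' k _ fun i => gridCeil_mem hBtop _).symm
  have hz : V.zHat σ B s = V.zHat σ B s' := by
    funext k ω i
    simp only [Variables.zHat, hsl]
  have hzG : V.zHatG σ B s = V.zHatG σ B s' := by
    funext k ω i
    simp only [Variables.zHatG, hsl]
  rw [hz, hzG]
  obtain ⟨hE, hmap⟩ := hV.map_entry_eq
  have hprob : IsProbabilityMeasure (μ.map fun ω l => V.entry l ω) :=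
    Measure.isProbabilityMeasure_map hE
  have hx : ∀ S : Finset (Fin 2), Measurable (restrict S ((coord M N).xHat σ B)) := fun S => by
    unfold restrict; fun_prop
  have hxG : ∀ S : Finset (Fin 2), Measurable (restrict S ((coord M N).xHatG σ B)) := fun S => by
    unfold restrict; fun_prop
  have hzm : ∀ S : Finset (Fin 2), Measurable (restrict S ((coord M N).zHat σ B s')) := fun S =>
    measurable_pi_lambda _ fun k => measurable_pi_lambda _ fun i =>
      measurable_coord_zHat σ B hs' k i
  have hzGm : ∀ S : Finset (Fin 2), Measurable (restrict S ((coord M N).zHatG σ B s')) := fun S =>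
    measurable_pi_lambda _ fun k => measurable_pi_lambda _ fun i =>
      measurable_coord_zHatG σ B hs' k i
  have hL := measurable_coord_levels (M := M) (N := N) σ B
  refine ⟨fun T => ?_, ?_⟩
  · have h := condMutualInfo_xHat_le (N := N) σ B T hMN hσ hs'
    simp only [← hmap] at h
    rw [← condMutualInfo_comp hE (hx T) (hzm T) ((hzm Tᶜ).prodMk hL),
      ← condMutualInfo_comp hE (hxG T) (hzGm T) ((hzGm Tᶜ).prodMk hL)] at h
    exact h
  · have h := condMutualInfo_x_le (N := N) σ B hMN hσ hs'
    simp only [← hmap] at h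
    have hxm : Measurable (coord M N).x := measurable_pi_lambda _ fun i => measurable_pi_apply _
    have h1 : Measurable fun ω k => (coord M N).zHat σ B s' k ω :=
      measurable_pi_lambda _ fun k => measurable_pi_lambda _ fun i =>
        measurable_coord_zHat σ B hs' k i
    have h2 : Measurable fun ω k => (coord M N).zHatG σ B s' k ω :=
      measurable_pi_lambda _ fun k => measurable_pi_lambda _ fun i =>
        measurable_coord_zHatG σ B hs' k i
    rw [← condMutualInfo_comp hE hxm h1 hL, ← condMutualInfo_comp hE hxm h2 hL] at h
    exact h
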